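/- **Setting.** Let $\mathbb T$ be a Galton--Watson tree with root $e$ and offspring distribution $(q_k)_{k\ge 0}$ satisfying $q_0=0$ and $1<m:=\sum_k kq_k<\infty$. Each vertex $x$ has $\nu(x)$ children $x_1,\dots,x_{\nu(x)}$ and parent $\overleftarrow{x}$; an extra vertex $\overleftarrow{e}$, of generation $-1$, is added as the parent of the root. Given the tree, attach to the vertices i.i.d. positive marks $A(x)$, distributed as a random variable $A$ with $0<\operatorname{ess\,inf}A\le\operatorname{ess\,sup}A<\infty$, and let $$\omega(x,x_i)=\frac{A(x_i)}{1+\sum_{j=1}^{\nu(x)}A(x_j)},\qquad \omega(x,\overleftarrow{x})=\frac{1}{1+\sum_{j=1}^{\nu(x)}A(x_j)},\qquad \omega(\overleftarrow e,e)=1 .$$ Let $\mathbf Q$ be the law of the environment (tree and marks), $P_\omega^e$ the law of the Markov chain $(X_n)_{n\ge0}$ started at $e$ with transition probabilities $\omega$, and $\mathbb Q^e=\int P^e_\omega\,d\mathbf Q$. Assume that $\inf_{t\in[0,1]}E[A^t]>1/m$, and that $\Lambda>1$, where $\Lambda$ is the Lebesgue measure of $\{t\in\mathbb R: E[A^t]\le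 1/q_1\}$ ($\Lambda=\infty$ if $q_1=0$). Let $\tau_n=\inf\{k\ge0:|X_k|=n\}$ be the hitting time of generation $n$. The values at $b=1$ of the annealed and quenched rate functions are the reals $I_a(1)$, $I_q(1)$ such that, for every $a<1$, $$\lim_{n\to\infty}\frac1n\ln\mathbb Q^e\Big(\frac{\tau_n}n\in\,]a,1]\Big)=-I_a(1),\qquad \lim_{n\to\infty}\frac1n\ln P_\omega^e\Big(\frac{\tau_n}n\in\,]a,1]\Big)=-I_q(1)\quad\mathbf Q\text{-a.s.}$$ **Proposition 1.3.** Let $\psi(\theta)=\ln E_{\mathbf Q}\big[\sum_{i=1}^{\nu(e)}\omega(e,e_i)^\theta\big]$. This expectation is finite for every $\theta\ge 0$, $\psi$ is differentiable at $1$, and $\psi(\theta)/\theta$ is bounded below on $]0,1]$. The limits above exist, and $$I_a(1)=-\psi(1),\qquad I_q(1)=-\inf_{\theta\in]0,1]}\frac{\psi(\theta)}{\theta}.$$ In particular, $I_a(1)=I_q(1)$ if and only if $\psi'(1)\le\psi(1)$; otherwise $I_a(1)<I_q(1)$. -/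

import Mathlib

open MeasureTheory ProbabilityTheory Filter Topology
open scoped ENNReal NNReal

/-!
Random walk in random environment on a Galton--Watson tree.

Vertices are coded by words of natural numbers (Ulam--Harris coding): `[]` is the root `e`, and
the children of `x` are `i :: x` for `i < ν(x)`, so that the parent of `i :: x` is `x` and the
generation of `x` is its length. -/

namespace RWRE

/-- The data at all words: `η x = (ν(x), A(x))` is the number of children and the mark of `x`.
Only the words belonging to the tree are ever visited by the walk. -/
abbrev Env : Type := List ℕ → ℕ × ℝ≥0

/-- The number of children `ν(x)`. -/
def numChildren (η : Env) (x : List ℕ) : ℕ := (η x).1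

/-- The mark `A(x)`. -/
def mark (η : Env) (x : List ℕ) : ℝ≥0 := (η x).2

/-- The law `𝐐` of the environment: numbers of children have law `q`, marks have law `α`, and all
of them are independent. -/
noncomputable def envLaw (q : PMF ℕ) (α : Measure ℝ≥0) : Measure Env :=
  Measure.infinitePi (fun _ : List ℕ => q.toMeasure.prod α)

/-- `ω(x, x_i) = A(x_i) / (1 + ∑_{j} A(x_j))`, for `i < ν(x)`. -/
noncomputable def childProb (η : Env) (x : List ℕ) (i : ℕ) : ℝ≥0 :=
  mark η (i :: x) / (1 + ∑ j ∈ Finset.range (numChildren η x), mark η (j :: x))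

/-- `ω(x, parent of x) = 1 / (1 + ∑_{j} A(x_j))`. -/
noncomputable def parentProb (η : Env) (x : List ℕ) : ℝ≥0 :=
  1 / (1 + ∑ j ∈ Finset.range (numChildren η x), mark η (j :: x))

/-- The state space of the walk: `some x` is the vertex `x`, and `none` is the additional parent
of the root. -/
def Site : Type := Option (List ℕ)

instance : Countable Site := inferInstanceAs (Countable (Option (List ℕ)))

instance : MeasurableSpace Site := ⊤

instance : DiscreteMeasurableSpace Site := ⟨fun _ => trivial⟩

namespace Site

/-- The vertex coded by a word, as a state of the walk. -/
def vertex (x : List ℕ) : Site := some x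

/-- The additional parent of the root. -/
def rootParent : Site := none

/-- The generation `|x|`; the additional parent of the root has generation `-1`. -/
def generation : Site → ℤ
  | none => -1
  | some x => x.length

/-- The parent of the vertex coded by a word. -/
def parent : List ℕ → Site
  | [] => rootParent
  | _ :: x => vertex x

end Site

/-- The one-step law `ω(x, ·)` of the walk; from the additional parent of the root, the walk moves
to the root. -/
noncomputable def stepLaw (η : Env) : Site → Measure Site
  | none => Measure.dirac (Site.vertex [])
  | some x =>
      (parentProb η x : ℝ≥0∞) • Measure.dirac (Site.parent x) +
        ∑ i ∈ Finset.range (numChildren η x),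
          (childProb η x i : ℝ≥0∞) • Measure.dirac (Site.vertex (i :: x))

instance (η : Env) (y : Site) : IsProbabilityMeasure (stepLaw η y) := by
  constructor
  cases y with
  | none => simp [stepLaw]
  | some x =>
    simp only [stepLaw, Measure.coe_add, Measure.coe_finsetSum, Pi.add_apply, Measure.smul_apply,
      Finset.sum_apply, measure_univ, smul_eq_mul, mul_one]
    rw [← ENNReal.ofNNReal_finsetSum, ← ENNReal.coe_add, ENNReal.coe_eq_one]
    have h : (1 + ∑ j ∈ Finset.range (numChildren η x), mark η (j :: x)) ≠ 0 := by positivity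
    simp only [parentProb, childProb]
    rw [← Finset.sum_div, ← add_div, div_self h]

/-- The transition kernel of the walk at time `n`, as a function of the path up to time `n`: it
only looks at the current position. -/
noncomputable def stepKernel (η : Env) (n : ℕ) :
    Kernel (Π _ : Finset.Iic n, Site) Site :=
  (Kernel.ofFunOfCountable (stepLaw η)).comap (fun p => p ⟨n, Finset.mem_Iic.2 le_rfl⟩)
    (measurable_pi_apply _)

instance (η : Env) (n : ℕ) : IsMarkovKernel (stepKernel η n) := by
  constructor
  intro p
  rw [stepKernel, Kernel.comap_apply]
  exact inferInstanceAs (IsProbabilityMeasure (stepLaw η _))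

/-- The quenched law `P_ω^y`: the law on the space of paths of the Markov chain with transition
probabilities `ω`, started at `y`. -/
noncomputable def quenchedLaw (η : Env) (y : Site) : Measure (ℕ → Site) :=
  Kernel.traj (X := fun _ => Site) (stepKernel η) 0 (fun _ => y)

/-- The annealed probability `ℚ^e(E) = ∫ P_ω^e(E) d𝐐` of an event for the walk started at the
root. -/
noncomputable def annealedProb (q : PMF ℕ) (α : Measure ℝ≥0) (E : Set (ℕ → Site)) : ℝ≥0∞ :=
  ∫⁻ η, quenchedLaw η (Site.vertex []) E ∂(envLaw q α)

/-- The hitting time `τ_n = inf {k ≥ 0 : |X_k| = n}` of generation `n`, with `inf ∅ = ∞`. -/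
noncomputable def hittingTime (n : ℕ) (X : ℕ → Site) : ℕ∞ :=
  ⨅ (k : ℕ) (_ : (X k).generation = n), (k : ℕ∞)

/-- The event `{τ_n / n ∈ ]a, b]}`. -/
def hittingEvent (n : ℕ) (a b : ℝ) : Set (ℕ → Site) :=
  {X | ∃ k : ℕ, hittingTime n X = k ∧ (k : ℝ) / n ∈ Set.Ioc a b}

/-- `r` is the value at `b` of the annealed rate function: for all `a < b`,
`(1/n) ln ℚ^e(τ_n / n ∈ ]a, b]) → -r`. Here `ln 0 = -∞`. -/
def IsAnnealedRateAt (q : PMF ℕ) (α : Measure ℝ≥0) (b r : ℝ) : Prop :=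
  ∀ a < b, Tendsto (fun n : ℕ => ENNReal.log (annealedProb q α (hittingEvent n a b)) / (n : EReal))
    atTop (𝓝 ((-r : ℝ) : EReal))

/-- `r` is the value at `b` of the quenched rate function: for all `a < b`,
`(1/n) ln P_ω^e(τ_n / n ∈ ]a, b]) → -r` for almost every environment. Here `ln 0 = -∞`. -/
def IsQuenchedRateAt (q : PMF ℕ) (α : Measure ℝ≥0) (b r : ℝ) : Prop :=
  ∀ a < b, ∀ᵐ η ∂(envLaw q α),
    Tendsto (fun n : ℕ =>
        ENNReal.log (quenchedLaw η (Site.vertex []) (hittingEvent n a b)) / (n : EReal))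
      atTop (𝓝 ((-r : ℝ) : EReal))

/-- `∑_{i ≤ ν(e)} ω(e, e_i)^θ`. -/
noncomputable def rootSum (θ : ℝ) (η : Env) : ℝ :=
  ∑ i ∈ Finset.range (numChildren η []), (childProb η [] i : ℝ) ^ θ

/-- `ψ(θ) = ln E_𝐐[∑_{i ≤ ν(e)} ω(e, e_i)^θ]`. -/
noncomputable def psi (q : PMF ℕ) (α : Measure ℝ≥0) (θ : ℝ) : ℝ :=
  Real.log (∫ η, rootSum θ η ∂(envLaw q α))

/-- The mean `m = ∑ k q_k` of the offspring distribution. -/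
noncomputable def meanOffspring (q : PMF ℕ) : ℝ≥0∞ := ∑' k : ℕ, (k : ℝ≥0∞) * q k

/-- `𝐄[A^t]`. -/
noncomputable def markMoment (α : Measure ℝ≥0) (t : ℝ) : ℝ := ∫ a : ℝ≥0, (a : ℝ) ^ t ∂α

open Classical in
/-- `Λ = Leb {t ∈ ℝ : 𝐄[A^t] ≤ 1 / q_1}`, and `Λ = ∞` if `q_1 = 0`. -/
noncomputable def bigLambda (q : PMF ℕ) (α : Measure ℝ≥0) : ℝ≥0∞ :=
  if q 1 = 0 then ⊤ else volume {t : ℝ | markMoment α t ≤ 1 / (q 1).toReal}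

end RWRE

/-! The walk starts in generation 0 and gains at most one generation per step, so it reaches
generation `n` by time `n` only by stepping away from the root `n` times in a row. For `a < 1` the
event `τ_n / n ∈ ]a, 1]` is therefore almost surely this ascent. Its quenched probability is the
partition function `Z_n(1)`, where `Z_n(θ)` is the sum over generation `n` of the `θ`-th powers of
the products of `ω` along the path from the root (`quenchedLaw_hittingEvent`). `Z_n(θ)` is a
multiplicative cascade (`cascade`), and by branching its mean is `e^{nψ(θ)}`. At `θ = 1` this is the
annealed rate.

The quenched rate is the free energy of `Z_n(1)`. For the upper bound, subadditivity of `t ↦ t^θ`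
gives `Z_n(1)^θ ≤ Z_n(θ)` for `θ ≤ 1`, and the first moment method bounds `Z_n(θ)`
(`eventually_cascade_le_exp`).

For the lower bound let `s` be the least minimiser of `ψ(θ)/θ` on `]0,1]`. It exists because `ψ(0) =
ln m > 0` makes the ratio blow up at `0`. If `b < s`, then `ψ(s)/s < ψ(b)/b`, which says `ψ((1+δ)b)
< (1+δ)ψ(b)` for `1+δ = s/b`. This is the condition under which the normalised cascade of exponent
`b` is bounded in `L^(1+δ)` and has a positive limit, so `Z_n(b)` grows like `e^{nψ(b)}` up to
subexponential factors (`eventually_le_cascade_weight`). Since `ln Z_n` is convex in the exponent,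
upper control at some `a < b` and lower control at `b` force `Z_n(1)` to be at least the linear
extrapolation from `a` and `b` to `1`. As `a` and `b` tend to `s` this becomes `ψ(s) + (1-s)ψ'(s) =
ψ(s)/s` (`exists_lt_extrapolation`, `eventually_exp_le_cascade`).

The two rates agree exactly when `ψ(θ)/θ` is minimal at `1`. By convexity of `ψ` this is the
condition `ψ'(1) ≤ ψ(1)`. -/

namespace RWRE

/-! ### Deterministic inequalities for cascades -/

/-- The total weight of the descendants of `x` that are `n` generations below `x`, when the edge
from `x` to `i :: x` carries the weight `u x i` and weights are multiplied along paths. -/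
noncomputable def cascade (u : List ℕ → ℕ → ℝ≥0∞) : ℕ → List ℕ → ℝ≥0∞
  | 0, _ => 1
  | n + 1, x => ∑' i, u x i * cascade u n (i :: x)

@[simp] lemma cascade_zero (u : List ℕ → ℕ → ℝ≥0∞) (x : List ℕ) : cascade u 0 x = 1 := rfl

lemma cascade_succ (u : List ℕ → ℕ → ℝ≥0∞) (n : ℕ) (x : List ℕ) :
    cascade u (n + 1) x = ∑' i, u x i * cascade u n (i :: x) := rfl

lemma cascade_mono {u v : List ℕ → ℕ → ℝ≥0∞} (h : ∀ x i, u x i ≤ v x i) (n : ℕ) (x : List ℕ) :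
    cascade u n x ≤ cascade v n x := by
  induction n generalizing x with
  | zero => exact le_rfl
  | succ n ih => exact ENNReal.tsum_le_tsum fun i => mul_le_mul' (h x i) (ih _)

lemma cascade_const_mul (c : ℝ≥0∞) (u : List ℕ → ℕ → ℝ≥0∞) (n : ℕ) (x : List ℕ) :
    cascade (fun x i => c * u x i) n x = c ^ n * cascade u n x := by
  induction n generalizing x with
  | zero => simp
  | succ n ih =>
    simp only [cascade_succ, ih, ← ENNReal.tsum_mul_left]
    refine tsum_congr fun i => ?_
    ring

lemma rpow_finset_sum_le {ι : Type*} (s : Finset ι) (f : ι → ℝ≥0∞) {θ : ℝ} (h0 : 0 < θ)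
    (h1 : θ ≤ 1) : (∑ i ∈ s, f i) ^ θ ≤ ∑ i ∈ s, f i ^ θ := by
  classical
  induction s using Finset.induction_on with
  | empty => simp [h0]
  | insert a s ha ih =>
    rw [Finset.sum_insert ha, Finset.sum_insert ha]
    exact (ENNReal.rpow_add_le_add_rpow _ _ h0.le h1).trans (by gcongr)

lemma rpow_tsum_le (f : ℕ → ℝ≥0∞) {θ : ℝ} (h0 : 0 < θ) (h1 : θ ≤ 1) :
    (∑' i, f i) ^ θ ≤ ∑' i, f i ^ θ := by
  have := (ENNReal.continuous_rpow_const (y := θ)).tendsto (∑' i, f i) |>.comp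
    (ENNReal.tendsto_nat_tsum f)
  refine le_of_tendsto' this fun n => ?_
  exact (rpow_finset_sum_le _ _ h0 h1).trans (ENNReal.sum_le_tsum _)

/-- Subadditivity of `t ↦ t^θ`, applied generation by generation. It transfers upper bounds from
exponent `θ` to exponent `1`. -/
lemma cascade_rpow_le (u : List ℕ → ℕ → ℝ≥0∞) {θ : ℝ} (h0 : 0 < θ) (h1 : θ ≤ 1) (n : ℕ)
    (x : List ℕ) : cascade u n x ^ θ ≤ cascade (fun x i => u x i ^ θ) n x := by
  induction n generalizing x with
  | zero => simp
  | succ n ih =>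
    refine (rpow_tsum_le _ h0 h1).trans (ENNReal.tsum_le_tsum fun i => ?_)
    rw [ENNReal.mul_rpow_of_nonneg _ _ h0.le]
    exact mul_le_mul' le_rfl (ih _)

lemma tsum_rpow_mul_rpow_le (f g : ℕ → ℝ≥0∞) {s t : ℝ} (hs : 0 ≤ s) (ht : 0 ≤ t)
    (hst : s + t = 1) : ∑' i, f i ^ s * g i ^ t ≤ (∑' i, f i) ^ s * (∑' i, g i) ^ t := by
  have := ENNReal.lintegral_mul_norm_pow_le (μ := Measure.count) (f := f) (g := g)
    (measurable_of_countable f).aemeasurable (measurable_of_countable g).aemeasurable hs ht hst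
  simpa [lintegral_count] using this

/-- Hölder's inequality: the logarithm of the partition function is convex. -/
lemma cascade_rpow_mul_rpow_le (u v : List ℕ → ℕ → ℝ≥0∞) {s t : ℝ} (hs : 0 ≤ s) (ht : 0 ≤ t)
    (hst : s + t = 1) (n : ℕ) (x : List ℕ) :
    cascade (fun x i => u x i ^ s * v x i ^ t) n x ≤ cascade u n x ^ s * cascade v n x ^ t := by
  induction n generalizing x with
  | zero => simp
  | succ n ih =>
    refine le_trans (ENNReal.tsum_le_tsum fun i => ?_) (tsum_rpow_mul_rpow_le _ _ hs ht hst)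
    rw [ENNReal.mul_rpow_of_nonneg _ _ hs, ENNReal.mul_rpow_of_nonneg _ _ ht]
    calc _ ≤ u x i ^ s * v x i ^ t * (cascade u n (i :: x) ^ s * cascade v n (i :: x) ^ t) :=
          mul_le_mul' le_rfl (ih _)
      _ = _ := by ring

/-- One factor of the power is kept linear and subadditivity is applied to the other, of exponent `δ
≤ 1`. Off the diagonal every exponent is then at most `1`, so for independent `y i` first moments
suffice there. -/
lemma rpow_one_add_sum_le {ι : Type*} [DecidableEq ι] (s : Finset ι) (y : ι → ℝ≥0∞) {δ : ℝ}
    (h0 : 0 < δ) (h1 : δ ≤ 1) :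
    (∑ i ∈ s, y i) ^ (1 + δ) ≤
      ∑ i ∈ s, y i ^ (1 + δ) + ∑ i ∈ s, ∑ j ∈ s.erase i, y i * y j ^ δ := by
  calc (∑ i ∈ s, y i) ^ (1 + δ) = (∑ i ∈ s, y i) * (∑ i ∈ s, y i) ^ δ := by
        rw [ENNReal.rpow_add_of_nonneg _ _ zero_le_one h0.le, ENNReal.rpow_one]
    _ ≤ (∑ i ∈ s, y i) * ∑ j ∈ s, y j ^ δ := by gcongr; exact rpow_finset_sum_le _ _ h0 h1
    _ = ∑ i ∈ s, (y i ^ (1 + δ) + ∑ j ∈ s.erase i, y i * y j ^ δ) := by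
        rw [Finset.sum_mul]
        refine Finset.sum_congr rfl fun i hi => ?_
        rw [← Finset.add_sum_erase s _ hi, mul_add, ← Finset.mul_sum,
          ENNReal.rpow_add_of_nonneg _ _ zero_le_one h0.le, ENNReal.rpow_one]
    _ = _ := Finset.sum_add_distrib

lemma measurable_tsum_ennreal {Ω : Type*} {m : MeasurableSpace Ω} {f : ℕ → Ω → ℝ≥0∞}
    (hf : ∀ i, Measurable (f i)) : Measurable fun ω => ∑' i, f i ω :=
  Measurable.tsum hf

/-! ### Independence over the tree and moments of order `1+δ` -/

section Independence

variable {Ω : Type*} {mΩ : MeasurableSpace Ω} {P : Measure Ω} {G : List ℕ → MeasurableSpace Ω}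
  {u : Ω → List ℕ → ℕ → ℝ≥0∞}

/-- The σ-algebra generated by the data at the words in `A`. -/
abbrev sigmaOn (G : List ℕ → MeasurableSpace Ω) (A : Set (List ℕ)) : MeasurableSpace Ω :=
  ⨆ x ∈ A, G x

/-- The data at disjoint sets of words are independent. -/
structure IndepWords (P : Measure Ω) (G : List ℕ → MeasurableSpace Ω) : Prop where
  le : ∀ x, G x ≤ mΩ
  indep : ∀ A B : Set (List ℕ), Disjoint A B → Indep (sigmaOn G A) (sigmaOn G B) P

lemma sigmaOn_mono {A B : Set (List ℕ)} (h : A ⊆ B) : sigmaOn G A ≤ sigmaOn G B :=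
  biSup_mono h

lemma le_sigmaOn {A : Set (List ℕ)} {x : List ℕ} (h : x ∈ A) : G x ≤ sigmaOn G A :=
  le_biSup G h

lemma IndepWords.sigmaOn_le (hG : IndepWords P G) (A : Set (List ℕ)) : sigmaOn G A ≤ mΩ :=
  iSup₂_le fun x _ => hG.le x

/-- The words of length less than `|x| + n` that extend `x`. -/
def descendants (x : List ℕ) (n : ℕ) : Set (List ℕ) := {y | x <:+ y ∧ y.length < x.length + n}

/-- The words that extend `x`. -/
def subtree (x : List ℕ) : Set (List ℕ) := {y | x <:+ y}

lemma descendants_subset_subtree (x : List ℕ) (n : ℕ) : descendants x n ⊆ subtree x :=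
  fun _ h => h.1

lemma descendants_cons_subset (x : List ℕ) (i n : ℕ) :
    descendants (i :: x) n ⊆ descendants x (n + 1) := fun y hy =>
  ⟨(List.suffix_cons i x).trans hy.1, by have := hy.2; simp only [List.length_cons] at this; omega⟩

lemma disjoint_singleton_subtree (x : List ℕ) (i : ℕ) :
    Disjoint {x} (subtree (i :: x)) := by
  rw [Set.disjoint_singleton_left]
  intro h
  have : (i :: x).length ≤ x.length := List.IsSuffix.length_le h
  simp at this

lemma disjoint_subtree_subtree (x : List ℕ) {i j : ℕ} (hij : i ≠ j) :
    Disjoint (subtree (i :: x)) (subtree (j :: x)) := by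
  rw [Set.disjoint_left]
  intro y hi hj
  have := (List.suffix_of_suffix_length_le (l₁ := i :: x) (l₂ := j :: x) hi hj (by simp))
  have := this.eq_of_length (by simp)
  exact hij (List.cons.inj this).1

/-- The weight of an edge is carried by its upper end, so the last generation contributes no data.
This strict bound on lengths is what the martingale property uses. -/
lemma measurable_cascade (hu : ∀ x i, Measurable[G x] fun ω => u ω x i) (n : ℕ) (x : List ℕ) :
    Measurable[sigmaOn G (descendants x n)] fun ω => cascade (u ω) n x := by
  induction n generalizing x with
  | zero => exact @measurable_const _ _ _ (_) _
  | succ n ih =>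
    simp only [cascade_succ]
    refine measurable_tsum_ennreal fun i => ?_
    refine @Measurable.mul _ _ _ _ _ (_) _ _ ?_ ?_
    · exact (hu x i).mono (le_sigmaOn ⟨List.suffix_rfl, by omega⟩) le_rfl
    · exact (ih (i :: x)).mono (sigmaOn_mono (descendants_cons_subset x i n)) le_rfl

lemma measurable_cascade_subtree (hu : ∀ x i, Measurable[G x] fun ω => u ω x i) (n : ℕ)
    (x : List ℕ) : Measurable[sigmaOn G (subtree x)] fun ω => cascade (u ω) n x :=
  (measurable_cascade hu n x).mono (sigmaOn_mono (descendants_subset_subtree x n)) le_rfl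

lemma IndepWords.measurable_cascade (hG : IndepWords P G)
    (hu : ∀ x i, Measurable[G x] fun ω => u ω x i) (n : ℕ)
    (x : List ℕ) : Measurable fun ω => cascade (u ω) n x :=
  (measurable_cascade_subtree hu n x).mono (hG.sigmaOn_le _) le_rfl

lemma IndepWords.lintegral_mul (hG : IndepWords P G) {A B : Set (List ℕ)} (hAB : Disjoint A B)
    {f g : Ω → ℝ≥0∞} (hf : Measurable[sigmaOn G A] f) (hg : Measurable[sigmaOn G B] g) :
    ∫⁻ ω, f ω * g ω ∂P = (∫⁻ ω, f ω ∂P) * ∫⁻ ω, g ω ∂P :=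
  lintegral_mul_eq_lintegral_mul_lintegral_of_independent_measurableSpace
    (hG.sigmaOn_le A) (hG.sigmaOn_le B) (hG.indep A B hAB) hf hg

lemma IndepWords.lintegral_mul_subtree (hG : IndepWords P G) (x : List ℕ) (i : ℕ)
    {f g : Ω → ℝ≥0∞} (hf : Measurable[G x] f) (hg : Measurable[sigmaOn G (subtree (i :: x))] g) :
    ∫⁻ ω, f ω * g ω ∂P = (∫⁻ ω, f ω ∂P) * ∫⁻ ω, g ω ∂P :=
  hG.lintegral_mul (disjoint_singleton_subtree x i)
    (hf.mono (le_sigmaOn (Set.mem_singleton x)) le_rfl) hg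

/-- The first moment of a cascade. -/
lemma IndepWords.lintegral_cascade [IsProbabilityMeasure P] (hG : IndepWords P G)
    (hu : ∀ x i, Measurable[G x] fun ω => u ω x i) {m : ℝ≥0∞}
    (hm : ∀ x, ∫⁻ ω, ∑' i, u ω x i ∂P = m) (n : ℕ) (x : List ℕ) :
    ∫⁻ ω, cascade (u ω) n x ∂P = m ^ n := by
  induction n generalizing x with
  | zero => simp
  | succ n ih =>
    simp only [cascade_succ]
    have hmeas : ∀ i, Measurable fun ω => u ω x i * cascade (u ω) n (i :: x) :=
      fun i => ((hu x i).mono (hG.le x) le_rfl).mul (hG.measurable_cascade hu n _)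
    rw [lintegral_tsum fun i => (hmeas i).aemeasurable]
    simp_rw [fun i => hG.lintegral_mul_subtree x i (hu x i)
      (measurable_cascade_subtree hu n (i :: x)), ih, ENNReal.tsum_mul_right]
    rw [← lintegral_tsum fun i => ((hu x i).mono (hG.le x) le_rfl).aemeasurable, hm, pow_succ']

lemma tsum_eq_sum_range_of_forall_ge {f : ℕ → ℝ≥0∞} {K : ℕ} (h : ∀ i, K ≤ i → f i = 0) :
    ∑' i, f i = ∑ i ∈ Finset.range K, f i :=
  tsum_eq_sum fun i hi => h i (by simpa using hi)

/-- A cascade with boundedly many bounded weights, of mean one, is bounded in `L^(1+δ)` as soon as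
the mean of the sum of the `(1+δ)`-th powers of the weights is less than one. -/
lemma IndepWords.exists_lintegral_cascade_rpow_le [IsProbabilityMeasure P] (hG : IndepWords P G)
    (hu : ∀ x i, Measurable[G x] fun ω => u ω x i) (hm : ∀ x, ∫⁻ ω, ∑' i, u ω x i ∂P = 1)
    {K : ℕ} (hK : ∀ ω x i, K ≤ i → u ω x i = 0) {C : ℝ≥0} (hC : ∀ ω x i, u ω x i ≤ C)
    {δ : ℝ} (h0 : 0 < δ) (h1 : δ ≤ 1) {κ : ℝ≥0∞} (hκ : κ < 1)
    (hp : ∀ x, ∫⁻ ω, ∑' i, u ω x i ^ (1 + δ) ∂P ≤ κ) :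
    ∃ M : ℝ≥0∞, M ≠ ⊤ ∧ 1 ≤ M ∧ ∀ n x, ∫⁻ ω, cascade (u ω) n x ^ (1 + δ) ∂P ≤ M := by
  have hum : ∀ x i, Measurable fun ω => u ω x i := fun x i => (hu x i).mono (hG.le x) le_rfl
  have hp0 : 0 ≤ 1 + δ := by linarith
  -- `D` bounds the off-diagonal part. There `X_j^δ ≤ 1 + X_j`, and the factor 2 is the mean of `X_i
  -- (1 + X_j)` for independent `X_i`, `X_j` of mean one.
  set D : ℝ≥0∞ := ∑ i ∈ Finset.range K, ∑ j ∈ (Finset.range K).erase i, (C : ℝ≥0∞) ^ (1 + δ) * 2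
    with hD
  have hDtop : D ≠ ⊤ := by
    refine ENNReal.sum_ne_top.2 fun i _ => ENNReal.sum_ne_top.2 fun j _ => ?_
    exact ENNReal.mul_ne_top (ENNReal.rpow_ne_top_of_nonneg hp0 ENNReal.coe_ne_top) (by simp)
  have hκ' : 1 - κ ≠ 0 := (tsub_pos_of_lt hκ).ne'
  have hκ'' : 1 - κ ≠ ⊤ := ENNReal.sub_ne_top ENNReal.one_ne_top
  -- `M = κ M + D + 1`, so the recursive bound `κ M + D` stays below `M`. The extra 1 gives `1 ≤ M`,
  -- which starts the induction.
  set M : ℝ≥0∞ := (D + 1) * (1 - κ)⁻¹ with hM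
  have hMD : (1 - κ) * M = D + 1 := by
    rw [hM, mul_comm, mul_assoc, ENNReal.inv_mul_cancel hκ' hκ'', mul_one]
  have hM1 : 1 ≤ M := by
    calc (1 : ℝ≥0∞) ≤ D + 1 := le_add_self
      _ = (1 - κ) * M := hMD.symm
      _ ≤ 1 * M := by gcongr; exact tsub_le_self
      _ = M := one_mul M
  refine ⟨M, ENNReal.mul_ne_top (by simp [hDtop]) (ENNReal.inv_ne_top.2 hκ'), hM1, ?_⟩
  intro n
  induction n with
  | zero => intro x; simpa using hM1
  | succ n ih =>
    intro x
    have hX := fun i => hG.measurable_cascade hu n (i :: x)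
    have hX' := fun i => measurable_cascade_subtree hu n (i :: x)
    have hEX := fun i => (hG.lintegral_cascade hu hm n (i :: x)).trans (one_pow n)
    have key : ∀ ω, cascade (u ω) (n + 1) x ^ (1 + δ) ≤
        ∑' i, u ω x i ^ (1 + δ) * cascade (u ω) n (i :: x) ^ (1 + δ) +
        ∑ i ∈ Finset.range K, ∑ j ∈ (Finset.range K).erase i,
          (C : ℝ≥0∞) ^ (1 + δ) * (cascade (u ω) n (i :: x) * (1 + cascade (u ω) n (j :: x))) := by
      intro ω
      rw [cascade_succ, tsum_eq_sum_range_of_forall_ge (K := K) fun i hi => by simp [hK ω x i hi]]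
      refine (rpow_one_add_sum_le _ _ h0 h1).trans (add_le_add ?_ ?_)
      · simp_rw [fun i => ENNReal.mul_rpow_of_nonneg (u ω x i) (cascade (u ω) n (i :: x)) hp0]
        exact ENNReal.sum_le_tsum _
      · refine Finset.sum_le_sum fun i _ => Finset.sum_le_sum fun j _ => ?_
        rw [ENNReal.mul_rpow_of_nonneg _ _ h0.le]
        calc u ω x i * cascade (u ω) n (i :: x) *
              (u ω x j ^ δ * cascade (u ω) n (j :: x) ^ δ)
            = u ω x i * u ω x j ^ δ * (cascade (u ω) n (i :: x) * cascade (u ω) n (j :: x) ^ δ) := by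
              ring
          _ ≤ C * (C : ℝ≥0∞) ^ δ *
              (cascade (u ω) n (i :: x) * (1 + cascade (u ω) n (j :: x))) := by
              gcongr
              · exact hC _ _ _
              · exact hC _ _ _
              · rcases le_total (cascade (u ω) n (j :: x)) 1 with h | h
                · exact (ENNReal.rpow_le_one h h0.le).trans le_self_add
                · calc _ ≤ cascade (u ω) n (j :: x) ^ (1 : ℝ) :=
                        ENNReal.rpow_le_rpow_of_exponent_le h h1
                    _ ≤ _ := by rw [ENNReal.rpow_one]; exact le_add_self
          _ = _ := by
              rw [ENNReal.rpow_add_of_nonneg _ _ zero_le_one h0.le, ENNReal.rpow_one]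
    have hmeas1 : ∀ i, Measurable fun ω =>
        u ω x i ^ (1 + δ) * cascade (u ω) n (i :: x) ^ (1 + δ) :=
      fun i => ((hum x i).pow_const _).mul ((hX i).pow_const _)
    calc ∫⁻ ω, cascade (u ω) (n + 1) x ^ (1 + δ) ∂P
        ≤ ∫⁻ ω, (∑' i, u ω x i ^ (1 + δ) * cascade (u ω) n (i :: x) ^ (1 + δ) +
          ∑ i ∈ Finset.range K, ∑ j ∈ (Finset.range K).erase i, (C : ℝ≥0∞) ^ (1 + δ) *
            (cascade (u ω) n (i :: x) * (1 + cascade (u ω) n (j :: x)))) ∂P := lintegral_mono key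
      _ = (∑' i, ∫⁻ ω, u ω x i ^ (1 + δ) * cascade (u ω) n (i :: x) ^ (1 + δ) ∂P) +
          ∑ i ∈ Finset.range K, ∑ j ∈ (Finset.range K).erase i, (C : ℝ≥0∞) ^ (1 + δ) *
            ∫⁻ ω, cascade (u ω) n (i :: x) * (1 + cascade (u ω) n (j :: x)) ∂P := by
          rw [lintegral_add_left (Measurable.tsum hmeas1),
            lintegral_tsum fun i => (hmeas1 i).aemeasurable,
            lintegral_finsetSum _ fun i _ => by fun_prop]
          congr 1
          refine Finset.sum_congr rfl fun i _ => ?_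
          rw [lintegral_finsetSum _ fun i _ => by fun_prop]
          refine Finset.sum_congr rfl fun j _ => ?_
          rw [lintegral_const_mul _ (by fun_prop)]
      _ ≤ κ * M + D := by
          refine add_le_add ?_ ?_
          · calc _ = ∑' i, (∫⁻ ω, u ω x i ^ (1 + δ) ∂P) *
                    ∫⁻ ω, cascade (u ω) n (i :: x) ^ (1 + δ) ∂P :=
                  tsum_congr fun i => hG.lintegral_mul_subtree x i
                    (@Measurable.pow_const _ _ _ _ _ _ _ (_) _ (hu x i) _)
                    (@Measurable.pow_const _ _ _ _ _ _ _ (_) _ (hX' i) _)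
              _ ≤ ∑' i, (∫⁻ ω, u ω x i ^ (1 + δ) ∂P) * M :=
                  ENNReal.tsum_le_tsum fun i => by gcongr; exact ih _
              _ = (∫⁻ ω, ∑' i, u ω x i ^ (1 + δ) ∂P) * M := by
                  rw [ENNReal.tsum_mul_right,
                    lintegral_tsum fun i => ((hum x i).pow_const _).aemeasurable]
              _ ≤ κ * M := by gcongr; exact hp x
          · refine Finset.sum_le_sum fun i _ => Finset.sum_le_sum fun j hj => ?_
            rw [hG.lintegral_mul (disjoint_subtree_subtree x (Finset.ne_of_mem_erase hj).symm)
              (hX' i) (@Measurable.const_add _ _ _ _ _ (_) _ (hX' j) _), hEX,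
              lintegral_add_left measurable_const, hEX]
            simp [one_add_one_eq_two]
      _ ≤ κ * M + (1 - κ) * M := by rw [hMD]; gcongr; exact le_self_add
      _ = M := by rw [← add_mul, add_tsub_cancel_of_le hκ.le, one_mul]

/-- A Paley–Zygmund argument with exponent `1+δ`. Pointwise `y ≤ 1/2 + R·1_{y ≥ 1/2} + R^{-δ}
y^(1+δ)`, the last term covering `y > R`. With `R^δ = 4M`, integration leaves mass at least `1/(4R)`
on `{y ≥ 1/2}`, uniformly in `y`. -/
lemma exists_le_measure_half_le [IsProbabilityMeasure P] {M : ℝ≥0∞} (hMtop : M ≠ ⊤) (hM1 : 1 ≤ M)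
    {δ : ℝ} (h0 : 0 < δ) : ∃ c : ℝ≥0∞, c ≠ 0 ∧ ∀ y : Ω → ℝ≥0∞, Measurable y →
      ∫⁻ ω, y ω ∂P = 1 → ∫⁻ ω, y ω ^ (1 + δ) ∂P ≤ M → c ≤ P {ω | 2⁻¹ ≤ y ω} := by
  have h4 : 4 * M ≠ ⊤ := ENNReal.mul_ne_top (by simp) hMtop
  have h4' : 4 * M ≠ 0 := by simp; exact (zero_lt_one.trans_le hM1).ne'
  set R : ℝ≥0∞ := (4 * M) ^ (1 / δ) with hR
  have hRtop : R ≠ ⊤ := ENNReal.rpow_ne_top_of_nonneg (by positivity) h4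
  have hR0 : R ≠ 0 := by
    rw [hR]; intro h
    rcases ENNReal.rpow_eq_zero_iff.1 h with h | h
    · exact h4' h.1
    · exact h4 h.1
  have hRδ : R ^ δ = 4 * M := by
    rw [hR, ← ENNReal.rpow_mul, one_div_mul_cancel h0.ne', ENNReal.rpow_one]
  refine ⟨4⁻¹ * R⁻¹, mul_ne_zero (by simp) (ENNReal.inv_ne_zero.2 hRtop), ?_⟩
  intro y hy hy1 hyM
  have hset : MeasurableSet {ω | 2⁻¹ ≤ y ω} := measurableSet_le measurable_const hy
  have key : ∀ ω, y ω ≤ 2⁻¹ + {ω | 2⁻¹ ≤ y ω}.indicator (fun _ => R) ω +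
      (4 * M)⁻¹ * y ω ^ (1 + δ) := by
    intro ω
    by_cases h : 2⁻¹ ≤ y ω
    · rcases le_total (y ω) R with h' | h'
      · refine h'.trans ?_
        rw [Set.indicator_of_mem (by exact h)]
        exact le_add_right le_add_self
      · refine le_trans ?_ le_add_self
        rw [ENNReal.rpow_add_of_nonneg _ _ zero_le_one h0.le, ENNReal.rpow_one]
        calc y ω = (4 * M)⁻¹ * (y ω * (4 * M)) := by
              rw [mul_comm (y ω), ← mul_assoc, ENNReal.inv_mul_cancel h4' h4, one_mul]
          _ ≤ _ := by rw [← hRδ]; gcongr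
    · exact (not_le.1 h).le.trans (by rw [add_assoc]; exact le_self_add)
  have h2 : (1 : ℝ≥0∞) ≤ 2⁻¹ + R * P {ω | 2⁻¹ ≤ y ω} + 4⁻¹ := by
    calc (1 : ℝ≥0∞) = ∫⁻ ω, y ω ∂P := hy1.symm
      _ ≤ ∫⁻ ω, (2⁻¹ + {ω | 2⁻¹ ≤ y ω}.indicator (fun _ => R) ω +
          (4 * M)⁻¹ * y ω ^ (1 + δ)) ∂P := lintegral_mono key
      _ = 2⁻¹ + R * P {ω | 2⁻¹ ≤ y ω} + (4 * M)⁻¹ * ∫⁻ ω, y ω ^ (1 + δ) ∂P := by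
          rw [lintegral_add_right _ (by fun_prop), lintegral_add_left measurable_const,
            lintegral_indicator_const hset, lintegral_const_mul _ (by fun_prop)]
          simp
      _ ≤ 2⁻¹ + R * P {ω | 2⁻¹ ≤ y ω} + (4 * M)⁻¹ * M := by gcongr
      _ = _ := by
          rw [ENNReal.mul_inv (by simp) (by simp), mul_assoc, ENNReal.inv_mul_cancel
            (zero_lt_one.trans_le hM1).ne' hMtop, mul_one]
  have h3 : (4 : ℝ≥0∞)⁻¹ ≤ R * P {ω | 2⁻¹ ≤ y ω} := by
    have e : (1 : ℝ≥0∞) = 4⁻¹ + (2⁻¹ + 4⁻¹) := by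
      rw [← ENNReal.toReal_eq_toReal_iff' (by simp) (by simp), ENNReal.toReal_add (by simp)
        (by simp), ENNReal.toReal_add (by simp) (by simp)]
      norm_num [ENNReal.toReal_inv]
    have e2 : 2⁻¹ + R * P {ω | 2⁻¹ ≤ y ω} + 4⁻¹ = R * P {ω | 2⁻¹ ≤ y ω} + (2⁻¹ + 4⁻¹) := by
      ring
    rw [e2] at h2
    nth_rw 1 [e] at h2
    exact (ENNReal.add_le_add_iff_right (by simp)).1 h2
  calc 4⁻¹ * R⁻¹ ≤ R * P {ω | 2⁻¹ ≤ y ω} * R⁻¹ := by gcongr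
    _ = P {ω | 2⁻¹ ≤ y ω} := by
      rw [mul_comm R, mul_assoc, ENNReal.mul_inv_cancel hR0 hRtop, mul_one]

end Independence

/-! ### Martingale convergence and non-degeneracy of the limit -/

section Martingale

variable {Ω : Type*} {mΩ : MeasurableSpace Ω} {P : Measure Ω} {G : List ℕ → MeasurableSpace Ω}
  {u : Ω → List ℕ → ℕ → ℝ≥0∞}

/-- The martingale property of a cascade with weights of mean one. -/
lemma IndepWords.lintegral_cascade_succ_mul (hG : IndepWords P G) [IsProbabilityMeasure P]
    (hu : ∀ x i, Measurable[G x] fun ω => u ω x i) (hm : ∀ x, ∫⁻ ω, ∑' i, u ω x i ∂P = 1)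
    (n : ℕ) (x : List ℕ) {g : Ω → ℝ≥0∞}
    (hg : Measurable[sigmaOn G {y | y.length < x.length + n}] g) :
    ∫⁻ ω, cascade (u ω) (n + 1) x * g ω ∂P = ∫⁻ ω, cascade (u ω) n x * g ω ∂P := by
  induction n generalizing x g with
  | zero =>
    rw [hG.lintegral_mul (A := descendants x 1) (B := {y | y.length < x.length + 0}) ?_
      (RWRE.measurable_cascade hu 1 x) hg, hG.lintegral_cascade hu hm]
    · simp
    · rw [Set.disjoint_left]
      intro y hy hy'
      have := hy.1.length_le
      simp only [Set.mem_ofPred_eq] at hy'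
      omega
  | succ n ih =>
    -- The weight of the first edge is absorbed into the test function, which remains measurable for
    -- the earlier generations. The induction hypothesis then applies at each child.
    rw [show (fun ω => cascade (u ω) (n + 1 + 1) x * g ω) = fun ω =>
      ∑' i, cascade (u ω) (n + 1) (i :: x) * (u ω x i * g ω) from ?_,
      show (fun ω => cascade (u ω) (n + 1) x * g ω) = fun ω =>
      ∑' i, cascade (u ω) n (i :: x) * (u ω x i * g ω) from ?_]
    · have hg' : ∀ i, Measurable[sigmaOn G {y | y.length < (i :: x).length + n}]
          fun ω => u ω x i * g ω := by
        intro i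
        have e : {y : List ℕ | y.length < (i :: x).length + n} =
            {y | y.length < x.length + (n + 1)} := by
          ext y; simp only [List.length_cons, Set.mem_ofPred_eq]; omega
        rw [e]
        refine @Measurable.mul _ _ _ _ _ (_) _ _ ?_ hg
        refine (hu x i).mono (le_sigmaOn ?_) le_rfl
        simp only [Set.mem_ofPred_eq]; omega
      have hmeas : ∀ k i, Measurable fun ω => cascade (u ω) k (i :: x) * (u ω x i * g ω) :=
        fun k i => (hG.measurable_cascade hu k _).mul ((hg' i).mono (hG.sigmaOn_le _) le_rfl)
      rw [lintegral_tsum fun i => (hmeas (n + 1) i).aemeasurable,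
        lintegral_tsum fun i => (hmeas n i).aemeasurable]
      exact tsum_congr fun i => ih (i :: x) (hg' i)
    · ext ω
      rw [cascade_succ, ← ENNReal.tsum_mul_right]
      exact tsum_congr fun i => by ring
    · ext ω
      rw [cascade_succ, ← ENNReal.tsum_mul_right]
      exact tsum_congr fun i => by ring

/-- The filtration of the generations. -/
def IndepWords.filtration (hG : IndepWords P G) : Filtration ℕ mΩ where
  seq n := sigmaOn G {y | y.length < n}
  mono' _ _ h := sigmaOn_mono fun _ hy => lt_of_lt_of_le hy h
  le' _ := hG.sigmaOn_le _

lemma IndepWords.martingale_cascade (hG : IndepWords P G) [IsProbabilityMeasure P]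
    (hu : ∀ x i, Measurable[G x] fun ω => u ω x i) (hm : ∀ x, ∫⁻ ω, ∑' i, u ω x i ∂P = 1) :
    Martingale (fun n ω => (cascade (u ω) n []).toReal) hG.filtration P := by
  have hmeas := fun n => hG.measurable_cascade hu n []
  have hint : ∀ n, ∫⁻ ω, cascade (u ω) n [] ∂P = 1 := fun n =>
    (hG.lintegral_cascade hu hm n []).trans (one_pow n)
  have hlt : ∀ n, ∀ᵐ ω ∂P, cascade (u ω) n [] < ⊤ := fun n =>
    ae_lt_top (hmeas n) (by rw [hint]; exact ENNReal.one_ne_top)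
  refine martingale_of_setIntegral_eq_succ (fun n => ?_) (fun n => ?_) fun n s hs => ?_
  · refine Measurable.stronglyMeasurable ?_
    refine @Measurable.ennreal_toReal _ (_) _ ?_
    refine (RWRE.measurable_cascade hu n []).mono (sigmaOn_mono fun y hy => ?_) le_rfl
    simpa using hy.2
  · exact integrable_toReal_of_lintegral_ne_top (hmeas n).aemeasurable (by simp [hint])
  · have hs' : MeasurableSet s := hG.filtration.le n s hs
    rw [integral_toReal (hmeas n).aemeasurable (ae_restrict_of_ae (hlt n)),
      integral_toReal (hmeas (n + 1)).aemeasurable (ae_restrict_of_ae (hlt (n + 1)))]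
    congr 1
    have := hG.lintegral_cascade_succ_mul hu hm n [] (g := s.indicator 1) (by
      refine @Measurable.indicator _ _ (_) _ _ _ _ (@measurable_const _ _ _ (_) 1) ?_
      have e0 : ([] : List ℕ).length + n = n := by simp
      rw [e0]
      exact hs)
    have e : ∀ k ω, cascade (u ω) k [] * s.indicator (1 : Ω → ℝ≥0∞) ω =
        s.indicator (fun ω => cascade (u ω) k []) ω := fun k ω => by
      by_cases h : ω ∈ s <;> simp [h]
    simp_rw [e, lintegral_indicator hs'] at this
    exact this.symm

/-- A nonnegative martingale of mean one is bounded in `L^1`, hence converges almost surely to a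
finite limit. -/
lemma IndepWords.exists_tendsto_cascade (hG : IndepWords P G) [IsProbabilityMeasure P]
    (hu : ∀ x i, Measurable[G x] fun ω => u ω x i) (hm : ∀ x, ∫⁻ ω, ∑' i, u ω x i ∂P = 1) :
    ∀ᵐ ω ∂P, ∃ c : ℝ≥0, Tendsto (fun n => cascade (u ω) n []) atTop (𝓝 c) := by
  have hmeas := fun n => hG.measurable_cascade hu n []
  have hint : ∀ n, ∫⁻ ω, cascade (u ω) n [] ∂P = 1 := fun n =>
    (hG.lintegral_cascade hu hm n []).trans (one_pow n)
  have hlt : ∀ᵐ ω ∂P, ∀ n, cascade (u ω) n [] < ⊤ := ae_all_iff.2 fun n =>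
    ae_lt_top (hmeas n) (by rw [hint]; exact ENNReal.one_ne_top)
  have := (hG.martingale_cascade hu hm).submartingale.exists_ae_tendsto_of_bdd (R := 1) fun n => by
    rw [eLpNorm_one_eq_lintegral_enorm, ENNReal.coe_one, ← hint n]
    refine lintegral_mono fun ω => ?_
    rw [Real.enorm_eq_ofReal ENNReal.toReal_nonneg]
    exact ENNReal.ofReal_toReal_le
  filter_upwards [this, hlt] with ω ⟨c, hc⟩ hω
  refine ⟨c.toNNReal, ?_⟩
  have h2 := ENNReal.tendsto_ofReal hc
  simp_rw [fun n => ENNReal.ofReal_toReal (hω n).ne] at h2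
  exact h2

/-- The probability that a cascade degenerates solves a strict inequality, hence vanishes. -/
lemma IndepWords.measure_tendsto_cascade_zero (hG : IndepWords P G) [IsProbabilityMeasure P]
    (hu : ∀ x i, Measurable[G x] fun ω => u ω x i) (hfin : ∀ ω x i, u ω x i ≠ ⊤)
    (h0 : ∀ x, ∀ᵐ ω ∂P, u ω x 0 ≠ 0) {r : ℝ≥0∞} (hr : r < 1)
    (h1 : ∀ x, P {ω | u ω x 1 = 0} ≤ r) {c : ℝ≥0∞} (hc0 : c ≠ 0)
    (hc : ∀ n x, c ≤ P {ω | 2⁻¹ ≤ cascade (u ω) n x}) (x : List ℕ) :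
    P {ω | Tendsto (fun n => cascade (u ω) n x) atTop (𝓝 0)} = 0 := by
  set B : List ℕ → Set Ω := fun x => {ω | Tendsto (fun n => cascade (u ω) n x) atTop (𝓝 0)}
    with hB
  have hBmeas' : ∀ x, MeasurableSet[sigmaOn G (subtree x)] (B x) := fun x =>
    @measurableSet_tendsto _ _ _ (_) _ _ _ _ _ _ _ _
      fun n => measurable_cascade_subtree hu n x
  have hBmeas : ∀ x, MeasurableSet (B x) := fun x => hG.sigmaOn_le _ _ (hBmeas' x)
  have hmeas := hG.measurable_cascade hu
  have hchild : ∀ x i ω, u ω x i ≠ 0 → ω ∈ B x → ω ∈ B (i :: x) := by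
    intro x i ω hne hω
    have h2 : Tendsto (fun n => (u ω x i)⁻¹ * cascade (u ω) (n + 1) x) atTop (𝓝 0) := by
      have := ENNReal.Tendsto.const_mul (a := (u ω x i)⁻¹) ((tendsto_add_atTop_iff_nat 1).2 hω)
        (Or.inr (ENNReal.inv_ne_top.2 hne))
      simpa using this
    refine tendsto_of_tendsto_of_tendsto_of_le_of_le tendsto_const_nhds h2
      (fun n => zero_le) fun n => ?_
    rw [cascade_succ]
    calc cascade (u ω) n (i :: x) = (u ω x i)⁻¹ * (u ω x i * cascade (u ω) n (i :: x)) := by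
          rw [← mul_assoc, ENNReal.inv_mul_cancel hne (hfin _ _ _), one_mul]
      _ ≤ _ := by gcongr; exact ENNReal.le_tsum i
  -- The supremum stands in for a common value of `P (B x)`, since equality in law of the cascades
  -- at different words is not assumed.
  set s : ℝ≥0∞ := ⨆ x, P (B x) with hs
  -- Convergence to zero puts the cascade below `1/2` from some time on, which has probability at
  -- most `1 - c` at each fixed time.
  have hs1 : s ≤ 1 - c := by
    refine iSup_le fun x => ?_
    have hsub : B x ⊆ ⋃ N, ⋂ n ≥ N, {ω | 2⁻¹ ≤ cascade (u ω) n x}ᶜ := by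
      intro ω hω
      obtain ⟨N, hN⟩ := eventually_atTop.1 (hω.eventually (gt_mem_nhds (by simp :
        (0 : ℝ≥0∞) < 2⁻¹)))
      exact Set.mem_iUnion.2 ⟨N, Set.mem_iInter₂.2 fun n hn => not_le.2 (hN n hn)⟩
    refine (measure_mono hsub).trans ?_
    rw [Monotone.measure_iUnion]
    · refine iSup_le fun N => ?_
      refine (measure_mono (Set.iInter₂_subset N le_rfl)).trans ?_
      rw [prob_compl_eq_one_sub (measurableSet_le measurable_const (hmeas N x))]
      exact tsub_le_tsub_left (hc N x) 1
    · intro a b hab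
      exact Set.iInter₂_mono' fun n hn => ⟨n, hab.trans hn, subset_rfl⟩
  have hslt : s < 1 := hs1.trans_lt (ENNReal.sub_lt_self ENNReal.one_ne_top one_ne_zero hc0)
  -- Degeneracy at `x` passes to each child of nonzero weight. Child `0` always qualifies, and off
  -- `E` so does child `1`, whose subtree is independent of the rest.
  have hle : ∀ x, P (B x) ≤ r * s + (1 - r) * (s * s) := by
    intro x
    set E : Set Ω := {ω | u ω x 1 = 0} with hE
    have hEm' : MeasurableSet[G x] E := (hu x 1) (measurableSet_singleton 0)
    have hEm : MeasurableSet E := hG.le x _ hEm'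
    have hEs : MeasurableSet[sigmaOn G {x}] E := le_sigmaOn (Set.mem_singleton x) _ hEm'
    have i1 : P (E ∩ B (0 :: x)) = P E * P (B (0 :: x)) :=
      (Indep_iff _ _ _).1 (hG.indep _ _ (disjoint_singleton_subtree x 0)) _ _ hEs (hBmeas' _)
    have hd : Disjoint ({x} ∪ subtree (0 :: x)) (subtree (1 :: x)) :=
      Set.disjoint_union_left.2
        ⟨disjoint_singleton_subtree x 1, disjoint_subtree_subtree x zero_ne_one⟩
    have i2 : P (Eᶜ ∩ B (0 :: x) ∩ B (1 :: x)) = P Eᶜ * P (B (0 :: x)) * P (B (1 :: x)) := by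
      rw [(Indep_iff _ _ _).1 (hG.indep _ _ hd) _ _ ?_ (hBmeas' _),
        (Indep_iff _ _ _).1 (hG.indep _ _ (disjoint_singleton_subtree x 0)) _ _
          (@MeasurableSet.compl _ _ (_) hEs) (hBmeas' _)]
      refine @MeasurableSet.inter _ (_) _ _ (@MeasurableSet.compl _ _ (_) ?_) ?_
      · exact sigmaOn_mono Set.subset_union_left _ hEs
      · exact sigmaOn_mono Set.subset_union_right _ (hBmeas' _)
    have hsub : B x ≤ᵐ[P] ((E ∩ B (0 :: x)) ∪ (Eᶜ ∩ B (0 :: x) ∩ B (1 :: x)) : Set Ω) := by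
      filter_upwards [h0 x] with ω hω hωB
      by_cases hω1 : ω ∈ E
      · exact Or.inl ⟨hω1, hchild x 0 ω hω hωB⟩
      · exact Or.inr ⟨⟨hω1, hchild x 0 ω hω hωB⟩, hchild x 1 ω hω1 hωB⟩
    have hb : ∀ y, P (B y) ≤ s := fun y => le_iSup (fun x => P (B x)) y
    -- This makes the bound nondecreasing in `P E`, so `P E` may be replaced by `r`.
    have hss : s * s ≤ s := mul_le_of_le_one_left' hslt.le
    calc P (B x) ≤ P (E ∩ B (0 :: x)) + P (Eᶜ ∩ B (0 :: x) ∩ B (1 :: x)) :=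
          (measure_mono_ae hsub).trans (measure_union_le _ _)
      _ ≤ P E * s + (1 - P E) * (s * s) := by
          rw [i1, i2, prob_compl_eq_one_sub hEm, mul_assoc]
          gcongr <;> exact hb _
      _ ≤ r * s + (1 - r) * (s * s) := by
          have e : r = P E + (r - P E) := (add_tsub_cancel_of_le (h1 x)).symm
          have e2 : 1 - P E = (1 - r) + (r - P E) := by
            rw [add_comm, tsub_add_tsub_cancel hr.le (h1 x) |>.symm, add_comm]
          rw [e2]
          nth_rw 3 [e]
          calc P E * s + ((1 - r) + (r - P E)) * (s * s)
              = P E * s + (1 - r) * (s * s) + (r - P E) * (s * s) := by ring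
            _ ≤ P E * s + (1 - r) * (s * s) + (r - P E) * s := by gcongr
            _ = _ := by ring
  have hs2 : s ≤ r * s + (1 - r) * (s * s) := iSup_le hle
  -- If `0 < s < 1`, then `r + (1 - r) s < 1`, and the recursive inequality would give `s < s`.
  have hs0 : s = 0 := by
    by_contra hne
    have hsfin : s ≠ ⊤ := (hslt.trans ENNReal.one_lt_top).ne
    have : s * (r + (1 - r) * s) < s * 1 := by
      refine ENNReal.mul_lt_mul_right hne hsfin ?_
      calc r + (1 - r) * s < r + (1 - r) * 1 := by
            refine ENNReal.add_lt_add_left (hr.trans ENNReal.one_lt_top).ne ?_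
            exact ENNReal.mul_lt_mul_right (tsub_pos_of_lt hr).ne'
              (ENNReal.sub_ne_top ENNReal.one_ne_top) hslt
        _ = 1 := by rw [mul_one, add_tsub_cancel_of_le hr.le]
    have e : s * (r + (1 - r) * s) = r * s + (1 - r) * (s * s) := by ring
    rw [e, mul_one] at this
    exact absurd hs2 (not_le.2 this)
  exact le_antisymm ((le_iSup (fun x => P (B x)) x).trans hs0.le) zero_le

/-- Under the `L^(1+δ)` condition, a cascade of mean one is eventually bounded away from zero. -/
lemma IndepWords.eventually_le_cascade (hG : IndepWords P G) [IsProbabilityMeasure P]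
    (hu : ∀ x i, Measurable[G x] fun ω => u ω x i) (hm : ∀ x, ∫⁻ ω, ∑' i, u ω x i ∂P = 1)
    {K : ℕ} (hK : ∀ ω x i, K ≤ i → u ω x i = 0) {C : ℝ≥0} (hC : ∀ ω x i, u ω x i ≤ C)
    {δ : ℝ} (hδ0 : 0 < δ) (hδ1 : δ ≤ 1) {κ : ℝ≥0∞} (hκ : κ < 1)
    (hp : ∀ x, ∫⁻ ω, ∑' i, u ω x i ^ (1 + δ) ∂P ≤ κ)
    (h0 : ∀ x, ∀ᵐ ω ∂P, u ω x 0 ≠ 0) {r : ℝ≥0∞} (hr : r < 1)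
    (h1 : ∀ x, P {ω | u ω x 1 = 0} ≤ r) :
    ∀ᵐ ω ∂P, ∃ c : ℝ, 0 < c ∧ ∀ᶠ n in atTop, ENNReal.ofReal c ≤ cascade (u ω) n [] := by
  obtain ⟨M, hMtop, hM1, hM⟩ :=
    hG.exists_lintegral_cascade_rpow_le hu hm hK hC hδ0 hδ1 hκ hp
  obtain ⟨c, hc0, hc⟩ := exists_le_measure_half_le (P := P) hMtop hM1 hδ0
  have hz := hG.measure_tendsto_cascade_zero hu
    (fun ω x i => ((hC ω x i).trans_lt ENNReal.coe_lt_top).ne) h0 hr h1 hc0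
    (fun n x => hc _ (hG.measurable_cascade hu n x)
      ((hG.lintegral_cascade hu hm n x).trans (one_pow n)) (hM n x)) []
  filter_upwards [hG.exists_tendsto_cascade hu hm, measure_eq_zero_iff_ae_notMem.1 hz]
    with ω ⟨b, hb⟩ hω
  have hb0 : 0 < b := by
    rw [pos_iff_ne_zero]
    rintro rfl
    exact hω (by simpa using hb)
  refine ⟨b / 2, by positivity, ?_⟩
  have : ENNReal.ofReal (b / 2) < b := by
    rw [← ENNReal.ofReal_coe_nnreal]
    exact (ENNReal.ofReal_lt_ofReal_iff (by positivity)).2 (half_lt_self (by positivity))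
  filter_upwards [hb.eventually (lt_mem_nhds this)] with n hn using hn.le

/-- The first moment bound for the growth of a cascade. -/
lemma IndepWords.eventually_cascade_le (hG : IndepWords P G) [IsProbabilityMeasure P]
    (hu : ∀ x i, Measurable[G x] fun ω => u ω x i) {ψ : ℝ}
    (hm : ∀ x, ∫⁻ ω, ∑' i, u ω x i ∂P = ENNReal.ofReal (Real.exp ψ)) {ε : ℝ} (hε : 0 < ε) :
    ∀ᵐ ω ∂P, ∀ᶠ n : ℕ in atTop,
      cascade (u ω) n [] ≤ ENNReal.ofReal (Real.exp (n * (ψ + ε))) := by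
  -- Markov's inequality gives summable tails, and Borel–Cantelli concludes.
  have hb : ∀ n : ℕ, P {ω | ENNReal.ofReal (Real.exp (n * (ψ + ε))) ≤ cascade (u ω) n []} ≤
      ENNReal.ofReal (Real.exp (-ε) ^ n) := by
    intro n
    refine (meas_ge_le_lintegral_div (hG.measurable_cascade hu n []).aemeasurable
      (by simp [Real.exp_pos]) ENNReal.ofReal_ne_top).trans ?_
    rw [hG.lintegral_cascade hu hm, ← ENNReal.ofReal_pow (Real.exp_pos _).le,
      ← ENNReal.ofReal_div_of_pos (Real.exp_pos _), ← Real.exp_nat_mul, ← Real.exp_nat_mul,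
      ← Real.exp_sub]
    exact (congrArg (fun t => ENNReal.ofReal (Real.exp t)) (by ring)).le
  have hsum : ∑' n : ℕ, P {ω | ENNReal.ofReal (Real.exp (n * (ψ + ε))) ≤ cascade (u ω) n []} ≠
      ⊤ := by
    refine ne_top_of_le_ne_top ?_ (ENNReal.tsum_le_tsum hb)
    rw [← ENNReal.ofReal_tsum_of_nonneg (fun n => by positivity)
      (summable_geometric_of_lt_one (Real.exp_pos _).le (Real.exp_lt_one_iff.2 (by linarith)))]
    exact ENNReal.ofReal_ne_top
  filter_upwards [ae_eventually_notMem hsum] with ω hω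
  filter_upwards [hω] with n hn
  exact (not_le.1 hn).le

end Martingale

/-! ### The environment as independent bundles and the growth of its cascades -/

section Environment

/-- The number of children of `x` and the marks of the words that follow `x`. -/
def bundle (η : Env) (x : List ℕ) : ℕ × (ℕ → ℝ≥0) :=
  (numChildren η x, fun i => mark η (i :: x))

/-- The `θ`-th power of the transition probability to the `i`-th child, as a function of the number
of children and of their marks. -/
noncomputable def bundleWeight (θ : ℝ) (b : ℕ × (ℕ → ℝ≥0)) (i : ℕ) : ℝ≥0∞ :=
  if i < b.1 then ((b.2 i / (1 + ∑ j ∈ Finset.range b.1, b.2 j) : ℝ≥0) : ℝ≥0∞) ^ θ else 0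

/-- The weight `ω(x, x_i)^θ`. -/
noncomputable def weight (θ : ℝ) (η : Env) (x : List ℕ) (i : ℕ) : ℝ≥0∞ :=
  bundleWeight θ (bundle η x) i

lemma weight_eq (θ : ℝ) (η : Env) (x : List ℕ) (i : ℕ) :
    weight θ η x i = if i < numChildren η x then (childProb η x i : ℝ≥0∞) ^ θ else 0 := rfl

lemma childProb_le_one (η : Env) (x : List ℕ) {i : ℕ} (hi : i < numChildren η x) :
    childProb η x i ≤ 1 := by
  refine div_le_one_of_le₀ ?_ zero_le
  refine le_trans ?_ le_add_self
  exact Finset.single_le_sum (f := fun j => mark η (j :: x)) (fun _ _ => zero_le)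
    (Finset.mem_range.2 hi)

lemma weight_le_one {θ : ℝ} (hθ : 0 ≤ θ) (η : Env) (x : List ℕ) (i : ℕ) : weight θ η x i ≤ 1 := by
  rw [weight_eq]
  split_ifs with h
  · exact ENNReal.rpow_le_one (by exact_mod_cast childProb_le_one η x h) hθ
  · exact zero_le

lemma measurable_bundle (x : List ℕ) : Measurable fun η : Env => bundle η x := by
  unfold bundle numChildren mark
  fun_prop

lemma measurable_bundleWeight (θ : ℝ) (i : ℕ) : Measurable fun b => bundleWeight θ b i := by
  refine measurable_from_prod_countable_right fun n => ?_
  unfold bundleWeight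
  by_cases h : i < n
  · simp only [h, if_true]
    fun_prop
  · simp only [h, if_false]
    exact measurable_const

/-- The σ-algebra of the data attached to `x` and its children. -/
abbrev bundleSigma (x : List ℕ) : MeasurableSpace Env :=
  MeasurableSpace.comap (fun η : Env => bundle η x) inferInstance

lemma measurable_weight (θ : ℝ) (x : List ℕ) (i : ℕ) :
    Measurable[bundleSigma x] fun η => weight θ η x i :=
  (measurable_bundleWeight θ i).comp (comap_measurable _)

variable (q : PMF ℕ) (α : Measure ℝ≥0)

/-- `E[∑_i ω(e, e_i)^θ]`. -/
noncomputable def meanWeight (θ : ℝ) : ℝ≥0∞ := ∫⁻ η, ∑' i, weight θ η [] i ∂envLaw q α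

lemma meanWeight_anti {s t : ℝ} (hst : s ≤ t) : meanWeight q α t ≤ meanWeight q α s := by
  refine lintegral_mono fun η => ENNReal.tsum_le_tsum fun i => ?_
  rw [weight_eq, weight_eq]
  split_ifs with h
  · exact ENNReal.rpow_le_rpow_of_exponent_ge (by exact_mod_cast childProb_le_one η [] h) hst
  · exact le_rfl

variable [IsProbabilityMeasure α]

instance isProbabilityMeasure_envLaw : IsProbabilityMeasure (envLaw q α) := by
  unfold envLaw; infer_instance

lemma map_eval_envLaw (x : List ℕ) :
    (envLaw q α).map (fun η => η x) = q.toMeasure.prod α :=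
  Measure.infinitePi_map_eval (fun _ : List ℕ => q.toMeasure.prod α) x

/-- The subtree at `x` consists of the words `y ++ x`, and a product of identical laws is invariant
under this injective reindexing. -/
lemma map_bundle_envLaw (x : List ℕ) :
    (envLaw q α).map (fun η => bundle η x) = (envLaw q α).map (fun η => bundle η []) := by
  have h := Measure.map_infinitePi_infinitePi_of_inj (P := fun _ : List ℕ => q.toMeasure.prod α)
    (f := fun y : List ℕ => y ++ x) (List.append_left_injective x)
  have h' : (envLaw q α).map (fun η y => η (y ++ x)) = envLaw q α := h
  conv_rhs => rw [← h']
  rw [Measure.map_map (measurable_bundle []) (by fun_prop)]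
  rfl

/-- The numbers of children and the marks, as a single family of random variables. -/
def coordinate (x : List ℕ) (b : Bool) (η : Env) : ℝ≥0 :=
  if b then mark η x else (numChildren η x : ℝ≥0)

lemma measurable_coordinate (x : List ℕ) (b : Bool) : Measurable (coordinate x b) := by
  unfold coordinate mark numChildren
  cases b <;> simp <;> fun_prop

/-- Independence between words is not fine enough: a bundle joins `ν(x)` to the marks of the
children of `x`, so `ν` and the mark at one word must also be separated. -/
lemma iIndepFun_coordinate :
    iIndepFun (fun (p : List ℕ × Bool) η => coordinate p.1 p.2 η) (envLaw q α) := by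
  refine iIndepFun_uncurry' (X := coordinate) measurable_coordinate ?_ fun x => ?_
  · refine iIndepFun_infinitePi (P := fun _ : List ℕ => q.toMeasure.prod α)
      (X := fun _ (p : ℕ × ℝ≥0) (b : Bool) => if b then p.2 else (p.1 : ℝ≥0)) fun x => ?_
    refine measurable_pi_lambda _ fun b => ?_
    cases b <;> simp <;> fun_prop
  · rw [iIndepFun_iff_measure_inter_preimage_eq_mul]
    intro S t ht
    have h2 : envLaw q α (coordinate x false ⁻¹' t false ∩ coordinate x true ⁻¹' t true) =
        envLaw q α (coordinate x false ⁻¹' t false) * envLaw q α (coordinate x true ⁻¹' t true) ∨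
        ¬ (false ∈ S ∧ true ∈ S) := by
      by_cases hS : false ∈ S ∧ true ∈ S
      swap; · exact Or.inr hS
      left
      have hf : MeasurableSet ((fun k : ℕ => (k : ℝ≥0)) ⁻¹' t false) := trivial
      have htt := ht true hS.2
      have e1 : coordinate x false ⁻¹' t false ∩ coordinate x true ⁻¹' t true =
          (fun η : Env => η x) ⁻¹' (((fun k : ℕ => (k : ℝ≥0)) ⁻¹' t false) ×ˢ t true) := rfl
      have e2 : coordinate x false ⁻¹' t false =
          (fun η : Env => η x) ⁻¹' (((fun k : ℕ => (k : ℝ≥0)) ⁻¹' t false) ×ˢ Set.univ) := by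
        ext η; simp [coordinate, numChildren]
      have e3 : coordinate x true ⁻¹' t true =
          (fun η : Env => η x) ⁻¹' (Set.univ ×ˢ t true) := by
        ext η; simp [coordinate, mark]
      rw [e1, e2, e3, ← Measure.map_apply (measurable_pi_apply x) (hf.prod htt),
        ← Measure.map_apply (measurable_pi_apply x) (hf.prod .univ),
        ← Measure.map_apply (measurable_pi_apply x) (MeasurableSet.univ.prod htt),
        map_eval_envLaw, Measure.prod_prod, Measure.prod_prod, Measure.prod_prod]
      simp
    have hS : S = ∅ ∨ S = {false} ∨ S = {true} ∨ S = {false, true} := by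
      revert S; intro S _ _; clear * -; revert S; decide
    rcases hS with rfl | rfl | rfl | rfl
    · simp
    · simp
    · simp
    · rcases h2 with h2 | h2
      · rw [Finset.set_biInter_insert, Finset.set_biInter_singleton, Finset.prod_pair (by simp)]
        exact h2
      · simp at h2

/-- The σ-algebra of a single coordinate. -/
abbrev coordinateSigma (p : List ℕ × Bool) : MeasurableSpace Env :=
  MeasurableSpace.comap (coordinate p.1 p.2) inferInstance

/-- The coordinates that appear in the bundle of `x`. -/
def bundleIndex (x : List ℕ) : Set (List ℕ × Bool) :=
  {p | p = (x, false) ∨ ∃ i, p = (i :: x, true)}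

lemma bundleSigma_le (x : List ℕ) : bundleSigma x ≤ ⨆ p ∈ bundleIndex x, coordinateSigma p := by
  rw [← measurable_iff_comap_le]
  have hc : ∀ p ∈ bundleIndex x,
      Measurable[⨆ p ∈ bundleIndex x, coordinateSigma p] (coordinate p.1 p.2) := by
    intro p hp
    exact (comap_measurable _).mono (le_biSup coordinateSigma hp) le_rfl
  refine @Measurable.prodMk _ _ _ _ _ (_) _ _ ?_ ?_
  -- The floor undoes the cast of `ν(x)` to `ℝ≥0` in `coordinate`.
  · have := Nat.measurable_floor.comp (hc (x, false) (Or.inl rfl))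
    have e : (fun η => numChildren η x) = Nat.floor ∘ (coordinate x false) := by
      ext η; simp [coordinate]
    rw [e]
    exact this
  · refine @measurable_pi_lambda _ _ _ (_) _ _ fun i => ?_
    exact hc (i :: x, true) (Or.inr ⟨i, rfl⟩)

lemma disjoint_bundleIndex {x y : List ℕ} (hxy : x ≠ y) :
    Disjoint (bundleIndex x) (bundleIndex y) := by
  rw [Set.disjoint_left]
  rintro p (rfl | ⟨i, rfl⟩) (h | ⟨j, h⟩) <;> simp_all

/-- Each mark of a non-root word belongs to the bundle of its parent only, so disjoint sets of words
use disjoint sets of independent coordinates. -/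
lemma indepWords_bundleSigma : IndepWords (envLaw q α) bundleSigma := by
  have hsup : ∀ A, sigmaOn bundleSigma A ≤ ⨆ p ∈ ⋃ x ∈ A, bundleIndex x, coordinateSigma p :=
    fun A => iSup₂_le fun x hx => (bundleSigma_le x).trans
      (biSup_mono fun p hp => Set.mem_biUnion hx hp)
  have hmle : ∀ p, coordinateSigma p ≤ MeasurableSpace.pi :=
    fun p => (measurable_coordinate p.1 p.2).comap_le
  refine ⟨fun x => (measurable_bundle x).comap_le, fun A B hAB => ?_⟩
  have hd : Disjoint (⋃ x ∈ A, bundleIndex x) (⋃ x ∈ B, bundleIndex x) := by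
    simp only [Set.disjoint_iUnion_left, Set.disjoint_iUnion_right]
    intro x hx y hy
    exact disjoint_bundleIndex (hAB.ne_of_mem hy hx)
  have hind := indep_iSup_of_disjoint hmle (iIndepFun_coordinate q α) hd
  exact indep_of_indep_of_le_left (indep_of_indep_of_le_right hind (hsup B)) (hsup A)

lemma lintegral_bundle (x : List ℕ) {f : ℕ × (ℕ → ℝ≥0) → ℝ≥0∞} (hf : Measurable f) :
    ∫⁻ η, f (bundle η x) ∂envLaw q α = ∫⁻ η, f (bundle η []) ∂envLaw q α := by
  rw [← lintegral_map hf (measurable_bundle x), map_bundle_envLaw,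
    lintegral_map hf (measurable_bundle [])]

lemma lintegral_tsum_weight (θ : ℝ) (x : List ℕ) :
    ∫⁻ η, ∑' i, weight θ η x i ∂envLaw q α = meanWeight q α θ :=
  lintegral_bundle q α x (f := fun b => ∑' i, bundleWeight θ b i)
    (measurable_tsum_ennreal fun i => measurable_bundleWeight θ i)

lemma measurable_weight' (θ : ℝ) (x : List ℕ) (i : ℕ) : Measurable fun η => weight θ η x i :=
  (measurable_weight θ x i).mono (measurable_bundle x).comap_le le_rfl

lemma tsum_weight_eq {θ : ℝ} (hθ : 0 ≤ θ) (η : Env) :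
    ∑' i, weight θ η [] i = ENNReal.ofReal (rootSum θ η) := by
  have h : ∀ i, numChildren η [] ≤ i → weight θ η [] i = 0 := fun i hi => by
    rw [weight_eq, if_neg (by omega)]
  rw [tsum_eq_sum_range_of_forall_ge h, rootSum,
    ENNReal.ofReal_sum_of_nonneg fun i _ => by positivity]
  refine Finset.sum_congr rfl fun i hi => ?_
  rw [weight_eq, if_pos (Finset.mem_range.1 hi), ← ENNReal.coe_rpow_of_nonneg _ hθ,
    ← NNReal.coe_rpow, ENNReal.ofReal_coe_nnreal]

lemma rootSum_nonneg (θ : ℝ) (η : Env) : 0 ≤ rootSum θ η :=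
  Finset.sum_nonneg fun i _ => by positivity

lemma rootSum_eq_toReal {θ : ℝ} (hθ : 0 ≤ θ) (η : Env) :
    rootSum θ η = (∑' i, weight θ η [] i).toReal := by
  rw [tsum_weight_eq hθ, ENNReal.toReal_ofReal (rootSum_nonneg θ η)]

lemma measurable_rootSum {θ : ℝ} (hθ : 0 ≤ θ) : Measurable (rootSum θ) := by
  rw [funext (rootSum_eq_toReal hθ)]
  exact (measurable_tsum_ennreal fun i => measurable_weight' θ [] i).ennreal_toReal

lemma lintegral_numChildren (x : List ℕ) :
    ∫⁻ η, (numChildren η x : ℝ≥0∞) ∂envLaw q α = meanOffspring q := by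
  have h : ∫⁻ η, (numChildren η x : ℝ≥0∞) ∂envLaw q α =
      ∫⁻ p, (p.1 : ℝ≥0∞) ∂((envLaw q α).map fun η => η x) := by
    rw [lintegral_map (by fun_prop) (by fun_prop)]; rfl
  rw [h, map_eval_envLaw, lintegral_prod _ (by fun_prop)]
  simp only [lintegral_const, measure_univ, mul_one]
  rw [lintegral_countable', meanOffspring]
  refine tsum_congr fun k => ?_
  rw [PMF.toMeasure_apply_singleton _ _ (measurableSet_singleton k)]

lemma meanWeight_zero : meanWeight q α 0 = meanOffspring q := by
  rw [meanWeight, ← lintegral_numChildren q α []]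
  refine lintegral_congr fun η => ?_
  rw [tsum_weight_eq le_rfl, rootSum]
  simp

variable {q α}

lemma meanWeight_lt_top (hm_fin : meanOffspring q < ⊤) {θ : ℝ} (hθ : 0 ≤ θ) :
    meanWeight q α θ < ⊤ :=
  (meanWeight_anti q α hθ).trans_lt (by rwa [meanWeight_zero])

lemma integrable_rootSum (hm_fin : meanOffspring q < ⊤) {θ : ℝ} (hθ : 0 ≤ θ) :
    Integrable (rootSum θ) (envLaw q α) := by
  rw [funext (rootSum_eq_toReal hθ)]
  exact integrable_toReal_of_lintegral_ne_top
    (measurable_tsum_ennreal fun i => measurable_weight' θ [] i).aemeasurable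
    (meanWeight_lt_top hm_fin hθ).ne

lemma ofReal_integral_rootSum (hm_fin : meanOffspring q < ⊤) {θ : ℝ} (hθ : 0 ≤ θ) :
    ENNReal.ofReal (∫ η, rootSum θ η ∂envLaw q α) = meanWeight q α θ := by
  rw [ofReal_integral_eq_lintegral_ofReal (integrable_rootSum hm_fin hθ)
    (ae_of_all _ (rootSum_nonneg θ)), meanWeight]
  exact lintegral_congr fun η => (tsum_weight_eq hθ η).symm

lemma ae_mark_pos (hA : ∃ c C : ℝ≥0, 0 < c ∧ ∀ᵐ a ∂α, c ≤ a ∧ a ≤ C) :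
    ∀ᵐ η ∂envLaw q α, ∀ x, 0 < mark η x := by
  obtain ⟨c, C, hc, h⟩ := hA
  refine ae_all_iff.2 fun x => ?_
  have h2 : ∀ᵐ p ∂(q.toMeasure.prod α), 0 < p.2 :=
    Measure.quasiMeasurePreserving_snd.ae (h.mono fun a ha => hc.trans_le ha.1)
  rw [← map_eval_envLaw q α x] at h2
  exact ae_of_ae_map (measurable_pi_apply x).aemeasurable h2

lemma measure_numChildren_mem (x : List ℕ) (s : Set ℕ) :
    envLaw q α {η | numChildren η x ∈ s} = q.toMeasure s := by
  have h : ((envLaw q α).map fun η => η x) (s ×ˢ Set.univ) =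
      (q.toMeasure.prod α) (s ×ˢ Set.univ) := by rw [map_eval_envLaw]
  rw [Measure.map_apply (measurable_pi_apply x)
    (((MeasurableSet.of_discrete (s := s))).prod .univ), Measure.prod_prod, measure_univ,
    mul_one] at h
  rw [← h]
  congr 1
  ext η
  simp [numChildren]

lemma ae_numChildren_pos (hq0 : q 0 = 0) : ∀ᵐ η ∂envLaw q α, ∀ x, 0 < numChildren η x := by
  refine ae_all_iff.2 fun x => ?_
  have h := measure_numChildren_mem (q := q) (α := α) x {0}
  rw [PMF.toMeasure_apply_singleton _ _ (measurableSet_singleton 0), hq0] at h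
  filter_upwards [measure_eq_zero_iff_ae_notMem.1 h] with η hη
  exact Nat.pos_of_ne_zero hη

lemma childProb_pos {η : Env} (hη : ∀ x, 0 < mark η x) (x : List ℕ) (i : ℕ) :
    0 < childProb η x i := div_pos (hη _) (by positivity)

lemma weight_ne_zero {η : Env} (hη : ∀ x, 0 < mark η x) (θ : ℝ) {x : List ℕ} {i : ℕ}
    (hi : i < numChildren η x) : weight θ η x i ≠ 0 := by
  rw [weight_eq, if_pos hi]
  exact (ENNReal.rpow_pos (by exact_mod_cast childProb_pos hη x i) ENNReal.coe_ne_top).ne'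

lemma meanWeight_pos (hq0 : q 0 = 0) (hA : ∃ c C : ℝ≥0, 0 < c ∧ ∀ᵐ a ∂α, c ≤ a ∧ a ≤ C) (θ : ℝ) :
    0 < meanWeight q α θ := by
  rw [pos_iff_ne_zero, meanWeight, Ne, lintegral_eq_zero_iff
    (measurable_tsum_ennreal fun i => measurable_weight' θ [] i)]
  intro h
  have : ∀ᵐ η ∂envLaw q α, False := by
    filter_upwards [h, ae_mark_pos hA, ae_numChildren_pos hq0] with η h1 h2 h3
    exact weight_ne_zero h2 θ (h3 []) (ENNReal.tsum_eq_zero.1 h1 0)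
  exact this.exists.choose_spec

lemma meanWeight_eq_ofReal_exp_psi (hq0 : q 0 = 0) (hm_fin : meanOffspring q < ⊤)
    (hA : ∃ c C : ℝ≥0, 0 < c ∧ ∀ᵐ a ∂α, c ≤ a ∧ a ≤ C) {θ : ℝ} (hθ : 0 ≤ θ) :
    meanWeight q α θ = ENNReal.ofReal (Real.exp (psi q α θ)) := by
  have h := ofReal_integral_rootSum (α := α) hm_fin hθ
  have hpos : 0 < ∫ η, rootSum θ η ∂envLaw q α := by
    rw [← ENNReal.ofReal_pos, h]; exact meanWeight_pos hq0 hA θ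
  rw [psi, Real.exp_log hpos, h]

lemma pmf_one_lt_one (hm : 1 < meanOffspring q) : q 1 < 1 := by
  refine lt_of_le_of_ne (q.coe_le_one 1) fun h => ?_
  have hs := (PMF.apply_eq_one_iff q 1).1 h
  have : meanOffspring q = 1 := by
    rw [meanOffspring, tsum_eq_single 1, h]
    · simp
    · intro k hk
      have : q k = 0 := by
        rw [PMF.apply_eq_zero_iff, hs]; simpa using hk
      simp [this]
  exact hm.ne' this

lemma measure_numChildren_le_one (hq0 : q 0 = 0) (x : List ℕ) :
    envLaw q α {η | numChildren η x ≤ 1} ≤ q 1 := by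
  calc envLaw q α {η | numChildren η x ≤ 1} = q.toMeasure {k | k ≤ 1} :=
        measure_numChildren_mem x {k | k ≤ 1}
    _ ≤ q.toMeasure ({0} ∪ {1}) := measure_mono fun k (hk : k ≤ 1) => by
        simp only [Set.mem_union, Set.mem_singleton_iff]; omega
    _ ≤ q.toMeasure {0} + q.toMeasure {1} := measure_union_le _ _
    _ = q 1 := by
        rw [PMF.toMeasure_apply_singleton _ _ (measurableSet_singleton 0),
          PMF.toMeasure_apply_singleton _ _ (measurableSet_singleton 1), hq0, zero_add]

/-- The first moment method for the `θ`-th powers of the transition probabilities. -/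
lemma eventually_cascade_weight_le (hq0 : q 0 = 0) (hm_fin : meanOffspring q < ⊤)
    (hA : ∃ c C : ℝ≥0, 0 < c ∧ ∀ᵐ a ∂α, c ≤ a ∧ a ≤ C) {θ : ℝ} (hθ : 0 ≤ θ) {ε : ℝ} (hε : 0 < ε) :
    ∀ᵐ η ∂envLaw q α, ∀ᶠ n : ℕ in atTop,
      cascade (weight θ η) n [] ≤ ENNReal.ofReal (Real.exp (n * (psi q α θ + ε))) :=
  (indepWords_bundleSigma q α).eventually_cascade_le (measurable_weight θ)
    (fun x => (lintegral_tsum_weight q α θ x).trans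
      (meanWeight_eq_ofReal_exp_psi hq0 hm_fin hA hθ)) hε

/-- The free energy of the cascade at a subcritical exponent. -/
lemma eventually_le_cascade_weight (hq0 : q 0 = 0) (hm : 1 < meanOffspring q)
    (hm_fin : meanOffspring q < ⊤) (hA : ∃ c C : ℝ≥0, 0 < c ∧ ∀ᵐ a ∂α, c ≤ a ∧ a ≤ C)
    {θ : ℝ} (hθ : 0 < θ) {δ : ℝ} (hδ0 : 0 < δ) (hδ1 : δ ≤ 1)
    (hψ : psi q α ((1 + δ) * θ) < (1 + δ) * psi q α θ) {ε : ℝ} (hε : 0 < ε) :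
    ∀ᵐ η ∂envLaw q α, ∀ᶠ n : ℕ in atTop,
      ENNReal.ofReal (Real.exp (n * (psi q α θ - ε))) ≤ cascade (weight θ η) n [] := by
  have hδ : 0 < 1 + δ := by linarith
  set Eθ := meanWeight q α θ with hEθ
  have hEeq : Eθ = ENNReal.ofReal (Real.exp (psi q α θ)) :=
    meanWeight_eq_ofReal_exp_psi hq0 hm_fin hA hθ.le
  -- Offspring numbers may be unbounded, while the `L^(1+δ)` bound needs boundedly many weights, so
  -- only the first `K` children are kept. `K` is large enough to preserve the strict moment
  -- condition and to cost at most `ε / 2` in the rate; `K ≥ 2` keeps the second child needed for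
  -- non-degeneracy.
  set EK : ℕ → ℝ≥0∞ := fun K => ∑ i ∈ Finset.range K, ∫⁻ η, weight θ η [] i ∂envLaw q α with hEK
  have hEK_tendsto : Tendsto EK atTop (𝓝 Eθ) := by
    have := ENNReal.tendsto_nat_tsum fun i => ∫⁻ η, weight θ η [] i ∂envLaw q α
    rwa [← lintegral_tsum fun i => (measurable_weight' θ [] i).aemeasurable] at this
  have hlt1 : meanWeight q α ((1 + δ) * θ) < Eθ ^ (1 + δ) := by
    rw [hEeq, meanWeight_eq_ofReal_exp_psi hq0 hm_fin hA (by positivity),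
      ENNReal.ofReal_rpow_of_pos (Real.exp_pos _), ← Real.exp_mul]
    refine (ENNReal.ofReal_lt_ofReal_iff (Real.exp_pos _)).2 (Real.exp_lt_exp.2 ?_)
    linarith
  have hlt2 : ENNReal.ofReal (Real.exp (psi q α θ - ε / 2)) < Eθ := by
    rw [hEeq]
    exact (ENNReal.ofReal_lt_ofReal_iff (Real.exp_pos _)).2 (Real.exp_lt_exp.2 (by linarith))
  obtain ⟨K, hK2, hK3, hK1⟩ := (((ENNReal.continuous_rpow_const.tendsto Eθ).comp
    hEK_tendsto).eventually (lt_mem_nhds hlt1)).and ((hEK_tendsto.eventually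
    (lt_mem_nhds hlt2)).and (eventually_ge_atTop 2)) |>.exists
  simp only [Function.comp_apply] at hK2
  have hEKpos : EK K ≠ 0 := (zero_le.trans_lt hK3).ne'
  have hEKtop : EK K ≠ ⊤ := by
    refine ne_top_of_le_ne_top (meanWeight_lt_top hm_fin hθ.le (α := α)).ne ?_
    rw [meanWeight, lintegral_tsum fun i => (measurable_weight' θ [] i).aemeasurable]
    exact ENNReal.sum_le_tsum _
  set c : ℝ≥0∞ := (EK K)⁻¹ with hc
  have hctop : c ≠ ⊤ := ENNReal.inv_ne_top.2 hEKpos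
  have hc0 : c ≠ 0 := ENNReal.inv_ne_zero.2 hEKtop
  set v : Env → List ℕ → ℕ → ℝ≥0∞ := fun η x i => if i < K then weight θ η x i else 0 with hv
  have hvw : ∀ η x i, v η x i ≤ weight θ η x i := fun η x i => by
    simp only [hv]; split_ifs
    · exact le_rfl
    · exact zero_le
  have hvK : ∀ η x i, K ≤ i → v η x i = 0 := fun η x i hi => if_neg (not_lt.2 hi)
  have hvm : ∀ x i, Measurable[bundleSigma x] fun η => v η x i := fun x i => by
    by_cases hi : i < K
    · simp only [hv, hi, if_true]; exact measurable_weight θ x i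
    · simp only [hv, hi, if_false]; exact @measurable_const _ _ _ (_) _
  set u : Env → List ℕ → ℕ → ℝ≥0∞ := fun η x i => c * v η x i with hu
  have hum : ∀ x i, Measurable[bundleSigma x] fun η => u η x i := fun x i =>
    @Measurable.const_mul _ _ _ _ _ (_) _ (hvm x i) c
  have hmean : ∀ x, ∫⁻ η, ∑' i, u η x i ∂envLaw q α = 1 := by
    intro x
    simp_rw [hu, ENNReal.tsum_mul_left, fun η => tsum_eq_sum_range_of_forall_ge (hvK η x)]
    have hvm' : ∀ i, Measurable fun η => v η x i := fun i =>
      (hvm x i).mono (measurable_bundle x).comap_le le_rfl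
    rw [lintegral_const_mul _ (by fun_prop), lintegral_finsetSum _ fun i _ => hvm' i]
    have : ∑ i ∈ Finset.range K, ∫⁻ η, v η x i ∂envLaw q α = EK K := by
      refine Finset.sum_congr rfl fun i hi => ?_
      simp only [hv, Finset.mem_range.1 hi, if_true]
      exact lintegral_bundle q α x (measurable_bundleWeight θ i)
    rw [this, hc, ENNReal.inv_mul_cancel hEKpos hEKtop]
  have hrpow : ∀ x, ∫⁻ η, ∑' i, u η x i ^ (1 + δ) ∂envLaw q α ≤
      c ^ (1 + δ) * meanWeight q α ((1 + δ) * θ) := by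
    intro x
    rw [← lintegral_tsum_weight q α _ x, ← lintegral_const_mul' _ _
      (ENNReal.rpow_ne_top_of_nonneg hδ.le hctop)]
    refine lintegral_mono fun η => ?_
    rw [← ENNReal.tsum_mul_left]
    refine ENNReal.tsum_le_tsum fun i => ?_
    simp only [hu]
    rw [ENNReal.mul_rpow_of_nonneg _ _ hδ.le]
    gcongr
    refine (ENNReal.rpow_le_rpow (hvw η x i) hδ.le).trans ?_
    rw [weight_eq, weight_eq]
    split_ifs
    · rw [← ENNReal.rpow_mul, mul_comm θ]
    · simp [hδ]
  have hκ : c ^ (1 + δ) * meanWeight q α ((1 + δ) * θ) < 1 := by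
    calc c ^ (1 + δ) * meanWeight q α ((1 + δ) * θ) < c ^ (1 + δ) * EK K ^ (1 + δ) :=
          ENNReal.mul_lt_mul_right (ENNReal.rpow_pos hc0.bot_lt hctop).ne'
            (ENNReal.rpow_ne_top_of_nonneg hδ.le hctop) hK2
      _ = 1 := by
          rw [← ENNReal.mul_rpow_of_nonneg _ _ hδ.le, hc, ENNReal.inv_mul_cancel hEKpos hEKtop,
            ENNReal.one_rpow]
  have hune : ∀ η, (∀ x, 0 < mark η x) → ∀ x i, i < K → i < numChildren η x → u η x i ≠ 0 := by
    intro η hη x i hi hi'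
    simp only [hu, hv, hi, if_true]
    exact mul_ne_zero hc0 (weight_ne_zero hη θ hi')
  have main := (indepWords_bundleSigma q α).eventually_le_cascade hum hmean
    (K := K) (fun η x i hi => by simp [hu, hvK η x i hi]) (C := c.toNNReal)
    (fun η x i => by
      rw [ENNReal.coe_toNNReal hctop]
      exact mul_le_of_le_one_right' ((hvw η x i).trans (weight_le_one hθ.le η x i)))
    hδ0 hδ1 hκ hrpow (fun x => by
      filter_upwards [ae_mark_pos hA, ae_numChildren_pos hq0] with η h1 h2
      exact hune η h1 x 0 (by omega) (h2 x)) (pmf_one_lt_one hm) (fun x => by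
      refine le_trans (measure_mono_ae ?_) (measure_numChildren_le_one hq0 x)
      filter_upwards [ae_mark_pos hA] with η h1
      intro (h : u η x 1 = 0)
      by_contra h'
      exact hune η h1 x 1 (by omega) (not_le.1 h') h)
  filter_upwards [main] with η ⟨b, hb, hη⟩
  -- The other half of `ε` absorbs the random constant `b`.
  have hgrow : ∀ᶠ n : ℕ in atTop, 1 ≤ b * Real.exp (n * (ε / 2)) := by
    have : Tendsto (fun n : ℕ => b * Real.exp (n * (ε / 2))) atTop atTop :=
      (Real.tendsto_exp_atTop.comp
        (tendsto_natCast_atTop_atTop.atTop_mul_const (by positivity))).const_mul_atTop hb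
    exact this.eventually_ge_atTop 1
  filter_upwards [hη, hgrow] with n hn hg
  simp only [hu] at hn
  rw [cascade_const_mul] at hn
  calc ENNReal.ofReal (Real.exp (n * (psi q α θ - ε)))
      ≤ ENNReal.ofReal (Real.exp (psi q α θ - ε / 2) ^ n * b) := by
        refine ENNReal.ofReal_le_ofReal ?_
        rw [← Real.exp_nat_mul]
        calc Real.exp (n * (psi q α θ - ε)) ≤
              Real.exp (n * (psi q α θ - ε)) * (b * Real.exp (n * (ε / 2))) :=
              le_mul_of_one_le_right (Real.exp_pos _).le hg
          _ = Real.exp (n * (psi q α θ - ε) + n * (ε / 2)) * b := by rw [Real.exp_add]; ring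
          _ = _ := by congr 2; ring
    _ = ENNReal.ofReal (Real.exp (psi q α θ - ε / 2)) ^ n * ENNReal.ofReal b := by
        rw [ENNReal.ofReal_mul (by positivity), ENNReal.ofReal_pow (Real.exp_pos _).le]
    _ ≤ EK K ^ n * (c ^ n * cascade (v η) n []) := by gcongr
    _ = cascade (v η) n [] := by
        rw [← mul_assoc, ← mul_pow, hc, ENNReal.mul_inv_cancel hEKpos hEKtop, one_pow, one_mul]
    _ ≤ _ := cascade_mono (hvw η) n []

end Environment

/-! ### Regularity and convexity of `ψ` -/

section Psi

/-- Hölder's inequality twice: over the children, then over the environment. -/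
lemma meanWeight_rpow_mul_rpow_le (q : PMF ℕ) (α : Measure ℝ≥0) {s t a b : ℝ} (hs : 0 ≤ s) (ht : 0 ≤ t) (ha : 0 ≤ a)
    (hb : 0 ≤ b) (hab : a + b = 1) :
    meanWeight q α (a * s + b * t) ≤ meanWeight q α s ^ a * meanWeight q α t ^ b := by
  have hmeas := fun θ => measurable_tsum_ennreal fun i => measurable_weight' θ [] i
  refine le_trans (lintegral_mono fun η => ?_)
    (ENNReal.lintegral_mul_norm_pow_le (hmeas s).aemeasurable (hmeas t).aemeasurable ha hb hab)
  refine le_trans (ENNReal.tsum_le_tsum fun i => ?_) (tsum_rpow_mul_rpow_le _ _ ha hb hab)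
  rw [weight_eq, weight_eq, weight_eq]
  split_ifs
  · rw [← ENNReal.rpow_mul, ← ENNReal.rpow_mul, ← ENNReal.rpow_add_of_nonneg _ _
      (by positivity) (by positivity), mul_comm s, mul_comm t]
  · exact zero_le

variable {q : PMF ℕ} {α : Measure ℝ≥0} [IsProbabilityMeasure α]

lemma measurable_numChildren (x : List ℕ) : Measurable fun η : Env => numChildren η x := by
  unfold numChildren
  fun_prop

lemma measurable_mark (x : List ℕ) : Measurable fun η : Env => mark η x := by
  unfold mark
  fun_prop

lemma measurable_one_add_sum_mark (x : List ℕ) : Measurable fun η : Env =>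
      1 + ∑ j ∈ Finset.range (numChildren η x), mark η (j :: x) := by
  have h : Measurable fun b : ℕ × Env => 1 + ∑ j ∈ Finset.range b.1, mark b.2 (j :: x) := by
    refine measurable_from_prod_countable_right fun n => ?_
    simp only
    have := measurable_mark
    fun_prop
  exact h.comp ((measurable_numChildren x).prodMk measurable_id)

lemma measurable_childProb (x : List ℕ) (i : ℕ) : Measurable fun η => childProb η x i :=
  (measurable_mark _).div (measurable_one_add_sum_mark x)

/-- The derivative of `rootSum` in the exponent. -/
noncomputable def rootSumDeriv (θ : ℝ) (η : Env) : ℝ :=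
  ∑ i ∈ Finset.range (numChildren η []), (childProb η [] i : ℝ) ^ θ * Real.log (childProb η [] i)

lemma measurable_sum_range_rootSumDeriv (θ : ℝ) :  Measurable fun b : ℕ × Env => ∑ i ∈ Finset.range b.1,
      (childProb b.2 [] i : ℝ) ^ θ * Real.log (childProb b.2 [] i) := by
    refine measurable_from_prod_countable_right fun n => ?_
    simp only
    have := measurable_childProb []
    fun_prop

lemma measurable_rootSumDeriv (θ : ℝ) : Measurable (rootSumDeriv θ) := by
  unfold rootSumDeriv
  have h : Measurable fun η : Env => (numChildren η [], η) :=
    (measurable_numChildren []).prodMk measurable_id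
  have h2 := (measurable_sum_range_rootSumDeriv θ).comp h
  simp only [Function.comp_def] at h2
  exact h2

lemma integrable_numChildren (hm_fin : meanOffspring q < ⊤) :
    Integrable (fun η => (numChildren η [] : ℝ)) (envLaw q α) := by
  refine (integrable_rootSum hm_fin le_rfl).congr (ae_of_all _ fun η => ?_)
  simp [rootSum]

lemma hasDerivAt_integral_rootSum (hm_fin : meanOffspring q < ⊤)
    (hA : ∃ c C : ℝ≥0, 0 < c ∧ ∀ᵐ a ∂α, c ≤ a ∧ a ≤ C) {θ : ℝ} (hθ : 0 < θ) :
    HasDerivAt (fun θ => ∫ η, rootSum θ η ∂envLaw q α) (∫ η, rootSumDeriv θ η ∂envLaw q α) θ := by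
  refine (hasDerivAt_integral_of_dominated_loc_of_deriv_le (s := Set.Ioi (θ / 2))
    -- For `0 < p ≤ 1` one has `|p^t ln p| ≤ 1/t`, so away from `t = 0` a finite mean offspring is
    -- enough for domination.
    (bound := fun η => numChildren η [] * (1 / (θ / 2)))
    (Ioi_mem_nhds (by linarith)) ?_ (integrable_rootSum hm_fin hθ.le)
    (measurable_rootSumDeriv θ).aestronglyMeasurable ?_
    ((integrable_numChildren hm_fin).mul_const _) ?_).2
  · filter_upwards [Ioi_mem_nhds hθ] with t ht
    exact (measurable_rootSum (le_of_lt ht)).aestronglyMeasurable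
  · filter_upwards [ae_mark_pos hA] with η hη t ht
    rw [rootSumDeriv]
    calc _ ≤ ∑ i ∈ Finset.range (numChildren η []), 1 / (θ / 2) := by
          refine norm_sum_le_of_le _ fun i hi => ?_
          have h0 : (0 : ℝ) < childProb η [] i := by exact_mod_cast childProb_pos hη [] i
          have h1 : (childProb η [] i : ℝ) ≤ 1 := by
            exact_mod_cast childProb_le_one η [] (Finset.mem_range.1 hi)
          have ht' : θ / 2 < t := ht
          rw [Real.norm_eq_abs, mul_comm]
          refine (Real.abs_log_mul_self_rpow_lt _ t h0 h1 (by linarith)).le.trans ?_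
          exact one_div_le_one_div_of_le (by linarith) ht'.le
      _ = _ := by simp
  · filter_upwards [ae_mark_pos hA] with η hη t ht
    refine HasDerivAt.fun_sum fun i hi => ?_
    have h0 : (0 : ℝ) < childProb η [] i := by exact_mod_cast childProb_pos hη [] i
    exact (Real.hasStrictDerivAt_const_rpow h0 t).hasDerivAt

lemma integral_rootSum_pos (hq0 : q 0 = 0) (hm_fin : meanOffspring q < ⊤)
    (hA : ∃ c C : ℝ≥0, 0 < c ∧ ∀ᵐ a ∂α, c ≤ a ∧ a ≤ C) {θ : ℝ} (hθ : 0 ≤ θ) :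
    0 < ∫ η, rootSum θ η ∂envLaw q α := by
  rw [← ENNReal.ofReal_pos, ofReal_integral_rootSum hm_fin hθ]
  exact meanWeight_pos hq0 hA θ

lemma differentiableAt_psi (hq0 : q 0 = 0) (hm_fin : meanOffspring q < ⊤)
    (hA : ∃ c C : ℝ≥0, 0 < c ∧ ∀ᵐ a ∂α, c ≤ a ∧ a ≤ C) {θ : ℝ} (hθ : 0 < θ) :
    DifferentiableAt ℝ (psi q α) θ :=
  ((hasDerivAt_integral_rootSum hm_fin hA hθ).log
    (integral_rootSum_pos hq0 hm_fin hA hθ.le).ne').differentiableAt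

lemma tendsto_psi_zero (hq0 : q 0 = 0) (hm_fin : meanOffspring q < ⊤)
    (hA : ∃ c C : ℝ≥0, 0 < c ∧ ∀ᵐ a ∂α, c ≤ a ∧ a ≤ C) :
    Tendsto (psi q α) (𝓝[>] 0) (𝓝 (psi q α 0)) := by
  refine Tendsto.log ?_ (integral_rootSum_pos hq0 hm_fin hA le_rfl).ne'
  refine tendsto_integral_filter_of_dominated_convergence (fun η => (numChildren η [] : ℝ))
    ?_ ?_ (integrable_numChildren hm_fin) ?_
  · filter_upwards [self_mem_nhdsWithin] with t ht
    exact (measurable_rootSum (le_of_lt ht)).aestronglyMeasurable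
  · filter_upwards [self_mem_nhdsWithin] with t ht
    refine ae_of_all _ fun η => ?_
    rw [Real.norm_eq_abs, abs_of_nonneg (rootSum_nonneg t η), rootSum]
    refine (Finset.sum_le_sum (g := fun _ => (1 : ℝ)) fun i hi => ?_).trans (by simp)
    exact Real.rpow_le_one (by positivity)
      (by exact_mod_cast childProb_le_one η [] (Finset.mem_range.1 hi)) (le_of_lt ht)
  · filter_upwards [ae_mark_pos hA] with η hη
    refine tendsto_finsetSum _ fun i _ => ?_
    have h0 : (0 : ℝ) < childProb η [] i := by exact_mod_cast childProb_pos hη [] i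
    exact ((Real.continuous_const_rpow h0.ne').tendsto 0).mono_left nhdsWithin_le_nhds

lemma psi_zero_pos (hm : 1 < meanOffspring q) (hm_fin : meanOffspring q < ⊤) :
    0 < psi q α 0 := by
  refine Real.log_pos ?_
  have := ofReal_integral_rootSum (α := α) hm_fin le_rfl
  rw [meanWeight_zero] at this
  rwa [← this, ENNReal.one_lt_ofReal] at hm

lemma convexOn_psi (hq0 : q 0 = 0) (hm_fin : meanOffspring q < ⊤)
    (hA : ∃ c C : ℝ≥0, 0 < c ∧ ∀ᵐ a ∂α, c ≤ a ∧ a ≤ C) :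
    ConvexOn ℝ (Set.Ici 0) (psi q α) := by
  refine ⟨convex_Ici 0, fun s (hs : 0 ≤ s) t (ht : 0 ≤ t) a b ha hb hab => ?_⟩
  have h := meanWeight_rpow_mul_rpow_le q α hs ht ha hb hab
  rw [meanWeight_eq_ofReal_exp_psi hq0 hm_fin hA hs, meanWeight_eq_ofReal_exp_psi hq0 hm_fin hA ht,
    meanWeight_eq_ofReal_exp_psi hq0 hm_fin hA (by positivity),
    ENNReal.ofReal_rpow_of_pos (Real.exp_pos _), ENNReal.ofReal_rpow_of_pos (Real.exp_pos _),
    ← ENNReal.ofReal_mul (by positivity), ENNReal.ofReal_le_ofReal_iff (by positivity),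
    ← Real.exp_mul, ← Real.exp_mul, ← Real.exp_add, Real.exp_le_exp] at h
  simp only [smul_eq_mul]
  linarith

end Psi

/-! ### The least minimiser of `ψ(θ)/θ` and extrapolation from it -/

section Minimiser

variable {ψ : ℝ → ℝ}

/-- The function `ψ(θ)/θ` has a least minimiser on `]0, 1]`. -/
lemma exists_least_minimiser (hdiff : ∀ θ, 0 < θ → DifferentiableAt ℝ ψ θ) {l : ℝ} (hl : 0 < l)
    (h0 : Tendsto ψ (𝓝[>] 0) (𝓝 l)) :
    ∃ s ∈ Set.Ioc (0 : ℝ) 1, (∀ θ ∈ Set.Ioc (0 : ℝ) 1, ψ s / s ≤ ψ θ / θ) ∧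
      ∀ θ ∈ Set.Ioo 0 s, ψ s / s < ψ θ / θ := by
  have htop : Tendsto (fun θ => ψ θ / θ) (𝓝[>] 0) atTop := by
    simp_rw [div_eq_mul_inv]
    exact h0.pos_mul_atTop hl tendsto_inv_nhdsGT_zero
  obtain ⟨d, hd0, hd⟩ := mem_nhdsGT_iff_exists_Ioo_subset.1 (htop.eventually_gt_atTop (ψ 1 / 1))
  have hd0 : 0 < d := hd0
  -- Below `e` the ratio exceeds its value at `1`, so the search reduces to the compact interval
  -- `[e, 1]`.
  set e := min d 1 with he
  have he0 : 0 < e := lt_min hd0 one_pos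
  have he1 : e ≤ 1 := min_le_right _ _
  have hcont : ContinuousOn (fun θ => ψ θ / θ) (Set.Icc e 1) := fun θ hθ =>
    (((hdiff θ (he0.trans_le hθ.1)).continuousAt).div continuousAt_id
      (he0.trans_le hθ.1).ne').continuousWithinAt
  obtain ⟨t, ht, htmin⟩ := isCompact_Icc.exists_isMinOn (Set.nonempty_Icc.2 he1) hcont
  have htall : ∀ θ ∈ Set.Ioc (0 : ℝ) 1, ψ t / t ≤ ψ θ / θ := by
    intro θ hθ
    rcases lt_or_ge θ e with h | h
    · have h1 : ψ 1 / 1 < ψ θ / θ := hd ⟨hθ.1, h.trans_le (min_le_left _ _)⟩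
      exact (htmin ⟨he1, le_rfl⟩).trans h1.le
    · exact htmin ⟨h, hθ.2⟩
  have hcl : IsCompact (Set.Icc e 1 ∩ (fun θ => ψ θ / θ) ⁻¹' {ψ t / t}) :=
    isCompact_Icc.of_isClosed_subset (hcont.preimage_isClosed_of_isClosed isClosed_Icc
      isClosed_singleton) Set.inter_subset_left
  obtain ⟨s, ⟨hs1, hs2⟩, hs3⟩ := hcl.exists_isLeast ⟨t, ht, rfl⟩
  have hs2 : ψ s / s = ψ t / t := hs2
  refine ⟨s, ⟨he0.trans_le hs1.1, hs1.2⟩, fun θ hθ => hs2 ▸ htall θ hθ, fun θ hθ => ?_⟩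
  have hθ1 : θ ∈ Set.Ioc (0 : ℝ) 1 := ⟨hθ.1, hθ.2.le.trans hs1.2⟩
  refine lt_of_le_of_ne (hs2 ▸ htall θ hθ1) fun heq => ?_
  rcases lt_or_ge θ e with h | h
  · have h1 : ψ 1 / 1 < ψ θ / θ := hd ⟨hθ.1, h.trans_le (min_le_left _ _)⟩
    have h2 : ψ t / t ≤ ψ 1 / 1 := htmin ⟨he1, le_rfl⟩
    linarith
  · exact absurd (hs3 ⟨⟨h, hθ1.2⟩, by simp [← heq, hs2]⟩) (not_le.2 hθ.2)

/-- Extrapolating `ψ` linearly from exponents just below the least minimiser of `ψ(θ)/θ` to the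
exponent `1` gives values close to the minimum. -/
lemma exists_lt_extrapolation (hdiff : ∀ θ, 0 < θ → DifferentiableAt ℝ ψ θ) {s : ℝ}
    (hs : s ∈ Set.Ioc (0 : ℝ) 1) (hmin : ∀ θ ∈ Set.Ioc (0 : ℝ) 1, ψ s / s ≤ ψ θ / θ) {ε : ℝ}
    (hε : 0 < ε) :
    ∃ a b, 0 < a ∧ a < b ∧ s / 2 ≤ b ∧ b < s ∧
      ψ s / s - ε < ψ b + (1 - b) * ((ψ b - ψ a) / (b - a)) := by
  have hs0 : 0 < s := hs.1
  -- At an interior minimiser the derivative of `ψ(θ)/θ` vanishes, so the tangent to `ψ` at `s`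
  -- passes through the origin. At `s = 1` nothing is extrapolated.
  have hval : ψ s + (1 - s) * deriv ψ s = ψ s / s := by
    rcases hs.2.eq_or_lt with rfl | hs1
    · simp
    · have hloc : IsLocalMin (fun θ => ψ θ / θ) s := by
        filter_upwards [Ioo_mem_nhds hs0 hs1] with θ hθ using hmin θ ⟨hθ.1, hθ.2.le⟩
      have hd := (hdiff s hs0).hasDerivAt.div (hasDerivAt_id s) hs0.ne'
      have := hloc.hasDerivAt_eq_zero hd
      simp only [id_eq, mul_one] at this
      rw [div_eq_zero_iff] at this
      rcases this with h | h
      · have : deriv ψ s = ψ s / s := by field_simp; linarith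
        rw [this]; field_simp; ring
      · exact absurd h (by positivity)
  have hslope : Tendsto (fun a => ψ s + (1 - s) * ((ψ s - ψ a) / (s - a))) (𝓝[<] s)
      (𝓝 (ψ s / s)) := by
    rw [← hval]
    have h1 := (hasDerivAt_iff_tendsto_slope.1 (hdiff s hs0).hasDerivAt).mono_left
      (nhdsWithin_mono s (fun x (hx : x < s) => hx.ne) : 𝓝[<] s ≤ 𝓝[≠] s)
    refine (tendsto_const_nhds.mul (h1.congr fun a => ?_)).const_add _
    rw [slope_def_field, ← neg_sub (ψ s), ← neg_sub s, neg_div_neg_eq]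
  obtain ⟨a, ha1, ha0, has⟩ := ((hslope.eventually (lt_mem_nhds (by linarith :
    ψ s / s - ε < ψ s / s))).and (Ioo_mem_nhdsLT hs0)).exists
  -- First `a` is chosen with the secant ending at `s`; with `a` fixed, `b` is then moved strictly
  -- below `s` by continuity. Keeping `b ≥ s / 2` ensures `s / b - 1 ≤ 1`, as required of `δ`.
  have hcont : ContinuousAt (fun b => ψ b + (1 - b) * ((ψ b - ψ a) / (b - a))) s := by
    have hc := (hdiff s hs0).continuousAt
    refine hc.add ((continuousAt_const.sub continuousAt_id).mul ((hc.sub continuousAt_const).div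
      (continuousAt_id.sub continuousAt_const) ?_))
    simpa using (sub_pos.2 has).ne'
  have hev := (hcont.eventually (lt_mem_nhds ha1)).filter_mono
    (nhdsWithin_le_nhds : 𝓝[<] s ≤ 𝓝 s)
  have hmax : max a (s / 2) < s := max_lt has (by linarith)
  obtain ⟨b, hb1, hb2, hb3⟩ := (hev.and (Ioo_mem_nhdsLT hmax)).exists
  exact ⟨a, b, ha0, (le_max_left _ _).trans_lt hb2, ((le_max_right _ _).trans_lt hb2).le, hb3, hb1⟩

end Minimiser

/-! ### From exponential bounds to limits of logarithms -/

section GrowthRate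

lemma ennreal_log_ofReal_exp (x : ℝ) : ENNReal.log (ENNReal.ofReal (Real.exp x)) = x := by
  rw [ENNReal.log_ofReal_of_pos (Real.exp_pos x), Real.log_exp]

lemma coe_natCast_mul_div (n : ℕ) (hn : n ≠ 0) (x : ℝ) :
    (((n * x : ℝ)) : EReal) / (n : EReal) = x := by
  rw [← EReal.coe_natCast, ← EReal.coe_div]
  have : (n : ℝ) ≠ 0 := by exact_mod_cast hn
  congr 1
  field_simp

/-- A sequence squeezed between exponentials has the corresponding growth rate. -/
lemma tendsto_log_div {Z : ℕ → ℝ≥0∞} {β : ℝ}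
    (hlow : ∀ ε > 0, ∀ᶠ n : ℕ in atTop, ENNReal.ofReal (Real.exp (n * (β - ε))) ≤ Z n)
    (hup : ∀ ε > 0, ∀ᶠ n : ℕ in atTop, Z n ≤ ENNReal.ofReal (Real.exp (n * (β + ε)))) :
    Tendsto (fun n : ℕ => ENNReal.log (Z n) / (n : EReal)) atTop (𝓝 (β : EReal)) := by
  rw [tendsto_order]
  refine ⟨fun a ha => ?_, fun a ha => ?_⟩
  · obtain ⟨x, hax, hxβ⟩ := EReal.lt_iff_exists_real_btwn.1 ha
    have hx : x < β := by exact_mod_cast hxβ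
    filter_upwards [hlow (β - x) (by linarith), eventually_ne_atTop 0] with n hn hn0
    refine hax.trans_le ?_
    rw [← coe_natCast_mul_div n hn0 x]
    refine EReal.div_le_div_right_of_nonneg (by positivity) ?_
    rw [← ennreal_log_ofReal_exp]
    refine ENNReal.log_monotone ?_
    simpa using hn
  · obtain ⟨x, hβx, hxa⟩ := EReal.lt_iff_exists_real_btwn.1 ha
    have hx : β < x := by exact_mod_cast hβx
    filter_upwards [hup (x - β) (by linarith), eventually_ne_atTop 0] with n hn hn0
    refine lt_of_le_of_lt ?_ hxa
    rw [← coe_natCast_mul_div n hn0 x]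
    refine EReal.div_le_div_right_of_nonneg (by positivity) ?_
    rw [← ennreal_log_ofReal_exp (n * x)]
    refine ENNReal.log_monotone ?_
    simpa using hn

lemma sInf_div_eq {ψ : ℝ → ℝ} {s : ℝ} (hs : s ∈ Set.Ioc (0 : ℝ) 1)
    (hmin : ∀ θ ∈ Set.Ioc (0 : ℝ) 1, ψ s / s ≤ ψ θ / θ) :
    sInf ((fun θ : ℝ => ψ θ / θ) '' Set.Ioc 0 1) = ψ s / s := by
  refine IsLeast.csInf_eq ⟨⟨s, hs, rfl⟩, ?_⟩
  rintro _ ⟨θ, hθ, rfl⟩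
  exact hmin θ hθ

end GrowthRate

/-! ### The quenched free energy -/

section FreeEnergy

variable {q : PMF ℕ} {α : Measure ℝ≥0} [IsProbabilityMeasure α]

lemma weight_one_rpow {θ : ℝ} (hθ : 0 < θ) (η : Env) (x : List ℕ) (i : ℕ) :
    weight 1 η x i ^ θ = weight θ η x i := by
  rw [weight_eq, weight_eq]
  split_ifs
  · rw [ENNReal.rpow_one]
  · simp [hθ]

lemma weight_interpolate {a t : ℝ} (ha : 0 ≤ a) (ht0 : 0 < t) (ht1 : t ≤ 1) (η : Env)
    (x : List ℕ) (i : ℕ) :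
    weight a η x i ^ (1 - t) * weight 1 η x i ^ t = weight ((1 - t) * a + t) η x i := by
  rw [weight_eq, weight_eq, weight_eq]
  split_ifs
  · rw [ENNReal.rpow_one, ← ENNReal.rpow_mul, ← ENNReal.rpow_add_of_nonneg _ _
      (mul_nonneg ha (by linarith)) ht0.le, mul_comm a]
  · simp [ht0]

lemma cascade_weight_le_rpow_mul_rpow {a t : ℝ} (ha : 0 ≤ a) (ht0 : 0 < t) (ht1 : t ≤ 1) (η : Env)
    (n : ℕ) : cascade (weight ((1 - t) * a + t) η) n [] ≤
      cascade (weight a η) n [] ^ (1 - t) * cascade (weight 1 η) n [] ^ t := by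
  have := cascade_rpow_mul_rpow_le (weight a η) (weight 1 η) (s := 1 - t) (t := t)
    (by linarith) ht0.le (by ring) n []
  simpa only [weight_interpolate ha ht0 ht1] using this

lemma ofReal_exp_rpow (x t : ℝ) :
    ENNReal.ofReal (Real.exp x) ^ t = ENNReal.ofReal (Real.exp (x * t)) := by
  rw [ENNReal.ofReal_rpow_of_pos (Real.exp_pos _), ← Real.exp_mul]

/-- Upper bound for the quenched free energy. -/
lemma eventually_cascade_le_exp (hq0 : q 0 = 0) (hm_fin : meanOffspring q < ⊤)
    (hA : ∃ c C : ℝ≥0, 0 < c ∧ ∀ᵐ a ∂α, c ≤ a ∧ a ≤ C) {s : ℝ} (hs : s ∈ Set.Ioc (0 : ℝ) 1)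
    {ε : ℝ} (hε : 0 < ε) :
    ∀ᵐ η ∂envLaw q α, ∀ᶠ n : ℕ in atTop,
      cascade (weight 1 η) n [] ≤ ENNReal.ofReal (Real.exp (n * (psi q α s / s + ε))) := by
  have hs0 : 0 < s := hs.1
  -- The error is `ε * s` because extracting the `s`-th root divides it by `s`.
  filter_upwards [eventually_cascade_weight_le hq0 hm_fin hA hs0.le (mul_pos hε hs0)] with η hη
  filter_upwards [hη] with n hn
  have h1 : cascade (weight 1 η) n [] ^ s ≤ cascade (weight s η) n [] := by
    have := cascade_rpow_le (weight 1 η) hs0 hs.2 n []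
    simpa only [weight_one_rpow hs0] using this
  have h2 := ENNReal.rpow_le_rpow (h1.trans hn) (inv_nonneg.2 hs0.le)
  rw [ENNReal.rpow_rpow_inv hs0.ne', ofReal_exp_rpow] at h2
  refine h2.trans (le_of_eq ?_)
  congr 2
  field_simp

/-- Lower bound for the quenched free energy. -/
lemma eventually_exp_le_cascade (hq0 : q 0 = 0) (hm : 1 < meanOffspring q)
    (hm_fin : meanOffspring q < ⊤)
    (hA : ∃ c C : ℝ≥0, 0 < c ∧ ∀ᵐ a ∂α, c ≤ a ∧ a ≤ C) {s : ℝ} (hs : s ∈ Set.Ioc (0 : ℝ) 1)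
    (hmin : ∀ θ ∈ Set.Ioc (0 : ℝ) 1, psi q α s / s ≤ psi q α θ / θ)
    (hleast : ∀ θ ∈ Set.Ioo 0 s, psi q α s / s < psi q α θ / θ) {ε : ℝ} (hε : 0 < ε) :
    ∀ᵐ η ∂envLaw q α, ∀ᶠ n : ℕ in atTop,
      ENNReal.ofReal (Real.exp (n * (psi q α s / s - ε))) ≤ cascade (weight 1 η) n [] := by
  have hs0 : 0 < s := hs.1
  obtain ⟨a, b, ha, hab, hsb, hbs, hext⟩ := exists_lt_extrapolation
    (fun θ => differentiableAt_psi hq0 hm_fin hA) hs hmin (half_pos hε)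
  have hb : 0 < b := ha.trans hab
  have hb1 : b < 1 := hbs.trans_le hs.2
  -- `t` is the weight that places `b` between `a` and `1`: `b = (1 - t) a + t`.
  set t : ℝ := (b - a) / (1 - a) with ht
  have ha1 : 0 < 1 - a := by linarith
  have ht0 : 0 < t := div_pos (by linarith) ha1
  have ht1 : t < 1 := (div_lt_one ha1).2 (by linarith)
  have hbt : (1 - t) * a + t = b := by rw [ht]; field_simp; ring
  have hδ : 1 + (s / b - 1) = s / b := by ring
  -- With `1 + δ = s / b` the higher exponent `(1 + δ) b` is exactly `s`, and the moment condition
  -- is the strict inequality `ψ(s)/s < ψ(b)/b`.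
  have hlow := eventually_le_cascade_weight (α := α) hq0 hm hm_fin hA hb (δ := s / b - 1)
    (by rw [sub_pos, one_lt_div hb]; exact hbs)
    (by rw [tsub_le_iff_right, div_le_iff₀ hb]; linarith)
    (by
      rw [hδ, div_mul_cancel₀ _ hb.ne']
      have := hleast b ⟨hb, hbs⟩
      rw [div_lt_div_iff₀ hs0 hb] at this
      rw [div_mul_eq_mul_div, lt_div_iff₀ hb]
      linarith) (ε := ε * t / 4) (by positivity)
  have hup := eventually_cascade_weight_le (α := α) hq0 hm_fin hA ha.le (ε := ε * t / 4)
    (by positivity)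
  filter_upwards [hlow, hup] with η h1 h2
  filter_upwards [h1, h2] with n hn1 hn2
  set y := psi q α b - ε * t / 4 with hy
  set z := psi q α a + ε * t / 4 with hz
  have h3 : ENNReal.ofReal (Real.exp (n * y)) ≤
      ENNReal.ofReal (Real.exp (n * z * (1 - t))) * cascade (weight 1 η) n [] ^ t := by
    refine hn1.trans ?_
    conv_lhs => rw [← hbt]
    refine (cascade_weight_le_rpow_mul_rpow ha.le ht0 ht1.le η n).trans ?_
    rw [← ofReal_exp_rpow]
    have h1t : 0 ≤ 1 - t := by linarith
    gcongr
  have h4 : ENNReal.ofReal (Real.exp (n * y - n * z * (1 - t))) ≤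
      cascade (weight 1 η) n [] ^ t := by
    have := mul_le_mul_right h3 (ENNReal.ofReal (Real.exp (-(n * z * (1 - t)))))
    rw [← mul_assoc, ← ENNReal.ofReal_mul (Real.exp_pos _).le,
      ← ENNReal.ofReal_mul (Real.exp_pos _).le, ← Real.exp_add, ← Real.exp_add,
      neg_add_cancel, Real.exp_zero, ENNReal.ofReal_one, one_mul, neg_add_eq_sub] at this
    exact this
  have h5 := ENNReal.rpow_le_rpow h4 (inv_nonneg.2 ht0.le)
  rw [ENNReal.rpow_rpow_inv ht0.ne', ofReal_exp_rpow] at h5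
  refine le_trans (ENNReal.ofReal_le_ofReal (Real.exp_le_exp.2 ?_)) h5
  -- Solving the Hölder bound for `Z_n(1)` yields the linear extrapolation. The two errors together
  -- cost `(ε / 4)(2 - t) < ε / 2`, and the choice of `a`, `b` costs the other half.
  have e1 : psi q α b + (1 - b) * ((psi q α b - psi q α a) / (b - a)) =
      (psi q α b - (1 - t) * psi q α a) * t⁻¹ := by
    have : b - a ≠ 0 := by linarith
    rw [ht]
    field_simp
    ring
  have e2 : (n * y - n * z * (1 - t)) * t⁻¹ =
      n * ((psi q α b - (1 - t) * psi q α a) * t⁻¹ - ε / 4 * (1 + (1 - t))) := by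
    rw [hy, hz]
    field_simp
    ring
  rw [e2, ← e1]
  refine mul_le_mul_of_nonneg_left ?_ (Nat.cast_nonneg n)
  nlinarith

/-- The exceptional null set may depend on `ε`; by monotonicity the countably many values `1/(k+1)`
suffice. -/
lemma ae_forall_pos_eventually {Ω : Type*} {mΩ : MeasurableSpace Ω} {P : Measure Ω}
    {p : ℝ → ℕ → Ω → Prop} (hp : ∀ ε > 0, ∀ᵐ ω ∂P, ∀ᶠ n in atTop, p ε n ω)
    (hmono : ∀ ε ε' n ω, ε ≤ ε' → p ε n ω → p ε' n ω) :
    ∀ᵐ ω ∂P, ∀ ε > 0, ∀ᶠ n in atTop, p ε n ω := by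
  have := ae_all_iff.2 fun k : ℕ => hp (1 / ((k : ℝ) + 1)) (by positivity)
  filter_upwards [this] with ω hω ε hε
  obtain ⟨k, hk⟩ := exists_nat_one_div_lt hε
  filter_upwards [hω k] with n hn using hmono _ _ _ _ hk.le hn

/-- The quenched free energy of the cascade of transition probabilities. -/
theorem tendsto_log_cascade_div (hq0 : q 0 = 0) (hm : 1 < meanOffspring q)
    (hm_fin : meanOffspring q < ⊤) (hA : ∃ c C : ℝ≥0, 0 < c ∧ ∀ᵐ a ∂α, c ≤ a ∧ a ≤ C) :
    ∀ᵐ η ∂envLaw q α,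
      Tendsto (fun n : ℕ => ENNReal.log (cascade (weight 1 η) n []) / (n : EReal)) atTop
        (𝓝 ((sInf ((fun θ : ℝ => psi q α θ / θ) '' Set.Ioc 0 1) : ℝ) : EReal)) := by
  obtain ⟨s, hs, hmin, hleast⟩ := exists_least_minimiser
    (fun θ => differentiableAt_psi hq0 hm_fin hA) (psi_zero_pos hm hm_fin)
    (tendsto_psi_zero hq0 hm_fin hA)
  rw [sInf_div_eq hs hmin]
  have hlow := ae_forall_pos_eventually
    (fun ε hε => eventually_exp_le_cascade hq0 hm hm_fin hA hs hmin hleast (ε := ε) hε)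
    (fun ε ε' n η h hn => le_trans (ENNReal.ofReal_le_ofReal (Real.exp_le_exp.2
      (mul_le_mul_of_nonneg_left (by linarith) (Nat.cast_nonneg n)))) hn)
  have hup := ae_forall_pos_eventually
    (fun ε hε => eventually_cascade_le_exp (α := α) hq0 hm_fin hA hs (ε := ε) hε)
    (fun ε ε' n η h hn => le_trans hn (ENNReal.ofReal_le_ofReal (Real.exp_le_exp.2
      (mul_le_mul_of_nonneg_left (by linarith) (Nat.cast_nonneg n)))))
  filter_upwards [hlow, hup] with η h1 h2 using tendsto_log_div h1 h2

end FreeEnergy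

/-! ### Fast hitting as an ascent of the walk -/

section Walk

variable (η : Env)

instance isProbabilityMeasure_quenchedLaw (y : Site) : IsProbabilityMeasure (quenchedLaw η y) := by
  unfold quenchedLaw; infer_instance

/-- The Markov property at time `k`. -/
lemma lintegral_quenchedLaw_succ (y : Site) (k : ℕ)
    (h : (Π _ : Finset.Iic k, Site) × Site → ℝ≥0∞) :
    ∫⁻ X, h (Preorder.frestrictLe k X, X (k + 1)) ∂quenchedLaw η y =
      ∫⁻ X, ∫⁻ z, h (Preorder.frestrictLe k X, z) ∂stepLaw η (X k) ∂quenchedLaw η y := by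
  have hm : Measurable h := Measurable.of_discrete
  have hm' : Measurable fun p : Π _ : Finset.Iic k, Site => ∫⁻ z, h (p, z) ∂stepKernel η k p :=
    Measurable.of_discrete
  have h1 := Kernel.partialTraj_compProd_eq_map_traj (X := fun _ => Site) (κ := stepKernel η) (Nat.zero_le k)
    (x₀ := fun _ : Finset.Iic 0 => y)
  have h2 : ∫⁻ X, h (Preorder.frestrictLe k X, X (k + 1)) ∂quenchedLaw η y =
      ∫⁻ p, h p ∂((quenchedLaw η y).map fun X => (Preorder.frestrictLe k X, X (k + 1))) := by
    rw [lintegral_map hm (by fun_prop)]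
  rw [h2, quenchedLaw, ← h1, Measure.lintegral_compProd hm,
    ← Kernel.traj_map_frestrictLe_apply, lintegral_map hm' (by fun_prop)]
  rfl

lemma ae_quenchedLaw_zero (y : Site) : ∀ᵐ X ∂quenchedLaw η y, X 0 = y := by
  have h : (quenchedLaw η y).map (Preorder.frestrictLe 0) =
      Measure.dirac (fun _ : Finset.Iic 0 => y) := by
    rw [quenchedLaw, Kernel.traj_map_frestrictLe_apply, Kernel.partialTraj_self, Kernel.id_apply]
  have h2 : ∀ᵐ p ∂(quenchedLaw η y).map (Preorder.frestrictLe (π := fun _ => Site) 0),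
      p ⟨0, Finset.mem_Iic.2 le_rfl⟩ = y := by
    rw [h, ae_dirac_iff (MeasurableSet.of_discrete)]
  exact ae_of_ae_map (Preorder.measurable_frestrictLe 0).aemeasurable h2

lemma lintegral_stepLaw_vertex (x : List ℕ) (f : Site → ℝ≥0∞) :
    ∫⁻ z, f z ∂stepLaw η (Site.vertex x) = parentProb η x * f (Site.parent x) +
      ∑ i ∈ Finset.range (numChildren η x), childProb η x i * f (Site.vertex (i :: x)) := by
  change ∫⁻ z, f z ∂((parentProb η x : ℝ≥0∞) • Measure.dirac (Site.parent x) +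
        ∑ i ∈ Finset.range (numChildren η x),
          (childProb η x i : ℝ≥0∞) • Measure.dirac (Site.vertex (i :: x))) = _
  rw [lintegral_add_measure, lintegral_smul_measure, lintegral_dirac,
    lintegral_finsetSum_measure]
  simp only [lintegral_smul_measure, lintegral_dirac, smul_eq_mul]

lemma generation_vertex (x : List ℕ) : (Site.vertex x).generation = x.length := rfl

lemma generation_parent (x : List ℕ) : (Site.parent x).generation = (x.length : ℤ) - 1 := by
  cases x with
  | nil => rfl
  | cons i x => simp [Site.parent, generation_vertex]

lemma lintegral_stepLaw_eq_zero (w : Site) {f : Site → ℝ≥0∞}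
    (hf : ∀ z, z.generation ≤ w.generation + 1 → f z = 0) : ∫⁻ z, f z ∂stepLaw η w = 0 := by
  cases w with
  | none =>
    change ∫⁻ z, f z ∂(Measure.dirac (Site.vertex [])) = 0
    rw [lintegral_dirac]
    exact hf _ le_rfl
  | some x =>
    have hf' : ∀ z : Site, z.generation ≤ x.length + 1 → f z = 0 := hf
    change ∫⁻ z, f z ∂stepLaw η (Site.vertex x) = 0
    rw [lintegral_stepLaw_vertex, hf' (Site.parent x) (by rw [generation_parent]; omega), mul_zero,
      zero_add]
    exact Finset.sum_eq_zero fun i _ => by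
      rw [hf' (Site.vertex (i :: x)) (by simp [generation_vertex]), mul_zero]

/-- The walk moves away from the root by at most one generation at each step. -/
lemma ae_generation_succ_le (y : Site) :
    ∀ᵐ X ∂quenchedLaw η y, ∀ k, (X (k + 1)).generation ≤ (X k).generation + 1 := by
  classical
  refine ae_all_iff.2 fun k => ?_
  have h := lintegral_quenchedLaw_succ η y k fun p =>
    if p.2.generation ≤ (p.1 ⟨k, Finset.mem_Iic.2 le_rfl⟩).generation + 1 then 0 else 1
  have h0 : ∫⁻ X : ℕ → Site, (if (X (k + 1)).generation ≤ (X k).generation + 1 then 0 else 1)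
      ∂quenchedLaw η y = 0 := by
    refine h.trans ((lintegral_congr fun X => ?_).trans lintegral_zero)
    exact lintegral_stepLaw_eq_zero η (X k) fun z hz => if_pos hz
  have hmeas : Measurable fun p : Site × Site =>
      (if p.1.generation ≤ p.2.generation + 1 then 0 else 1 : ℝ≥0∞) := Measurable.of_discrete
  have hmeas2 : Measurable fun X : ℕ → Site => (X (k + 1), X k) := by fun_prop
  replace h0 := (lintegral_eq_zero_iff (hmeas.comp hmeas2)).1 h0
  filter_upwards [h0] with X hX
  by_contra hne
  simp [hne] at hX

/-- The paths that move away from the root during their first `n` steps. -/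
def ascending (n : ℕ) : Set (ℕ → Site) := {X | ∀ k ≤ n, (X k).generation = k}

/-- The cascade of transition probabilities as a function of the state of the walk. -/
noncomputable def siteCascade (n : ℕ) : Site → ℝ≥0∞
  | none => 0
  | some x => cascade (weight 1 η) n x

/-- The recursion of the cascade is the backward equation of the walk restricted to upward steps:
the indicator removes the step to the parent. -/
lemma lintegral_stepLaw_siteCascade (n k : ℕ) (w : Site) (hw : w.generation = k) :
    ∫⁻ z, (if z.generation = (k + 1 : ℕ) then siteCascade η n z else 0) ∂stepLaw η w =
      siteCascade η (n + 1) w := by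
  cases w with
  | none => simp [Site.generation] at hw
  | some x =>
    change ∫⁻ z, _ ∂stepLaw η (Site.vertex x) = cascade (weight 1 η) (n + 1) x
    have hx : (x.length : ℤ) = k := hw
    rw [lintegral_stepLaw_vertex, generation_parent, if_neg (by push_cast; omega), mul_zero,
      zero_add, cascade_succ, tsum_eq_sum_range_of_forall_ge (K := numChildren η x)
        fun i hi => by rw [weight_eq, if_neg (by omega), zero_mul]]
    refine Finset.sum_congr rfl fun i hi => ?_
    rw [generation_vertex, if_pos (by simp [hx]), weight_eq, if_pos (Finset.mem_range.1 hi),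
      ENNReal.rpow_one]
    rfl

lemma measurableSet_ascending (n : ℕ) : MeasurableSet (ascending n) := by
  have : ascending n = ⋂ k ≤ n, (fun X : ℕ → Site => X k) ⁻¹' {z | z.generation = k} := by
    ext X; simp [ascending]
  rw [this]
  exact MeasurableSet.iInter fun k => MeasurableSet.iInter fun _ =>
    measurable_pi_apply k MeasurableSet.of_discrete

/-- By the Markov property the last step of the ascent is traded for one more generation of the
cascade. Iterating moves the whole ascent into the cascade. -/
lemma lintegral_ascending_succ (y : Site) (n k : ℕ) :
    ∫⁻ X in ascending (k + 1), siteCascade η n (X (k + 1)) ∂quenchedLaw η y =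
      ∫⁻ X in ascending k, siteCascade η (n + 1) (X k) ∂quenchedLaw η y := by
  classical
  have h := lintegral_quenchedLaw_succ η y k fun p =>
    if ∀ i, (p.1 i).generation = (i : ℕ) then
      (if p.2.generation = (k + 1 : ℕ) then siteCascade η n p.2 else 0) else 0
  have hasc : ∀ X : ℕ → Site, X ∈ ascending k ↔
      ∀ i : Finset.Iic k, (Preorder.frestrictLe k X i).generation = (i : ℕ) := fun X => by
    simp [ascending, Preorder.frestrictLe]
  rw [← lintegral_indicator (measurableSet_ascending _),
    ← lintegral_indicator (measurableSet_ascending _)]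
  convert h using 1
  · refine lintegral_congr fun X => ?_
    simp only [← hasc]
    rw [Set.indicator_apply]
    have e : X ∈ ascending (k + 1) ↔ X ∈ ascending k ∧ (X (k + 1)).generation = (k + 1 : ℕ) := by
      constructor
      · exact fun hX => ⟨fun j hj => hX j (by omega), hX _ le_rfl⟩
      · rintro ⟨h1, h2⟩ j hj
        rcases Nat.lt_or_ge k j with hkj | hkj
        · obtain rfl : j = k + 1 := by omega
          exact h2
        · exact h1 j hkj
    by_cases h1 : X ∈ ascending k <;> by_cases h2 : (X (k + 1)).generation = (k + 1 : ℕ) <;>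
      simp only [e, h1, h2, and_self, if_true, if_false, and_true, and_false]
  · refine lintegral_congr fun X => ?_
    simp only [← hasc]
    rw [Set.indicator_apply]
    by_cases h1 : X ∈ ascending k
    · simp only [h1, if_true]
      exact (lintegral_stepLaw_siteCascade η n k (X k) (h1 k le_rfl)).symm
    · simp [h1]

lemma quenchedLaw_ascending_add (y : Site) (n k : ℕ) :
    quenchedLaw η y (ascending (k + n)) =
      ∫⁻ X in ascending k, siteCascade η n (X k) ∂quenchedLaw η y := by
  induction n generalizing k with
  | zero =>
    rw [← setLIntegral_one]
    refine setLIntegral_congr_fun (measurableSet_ascending _) fun X hX => ?_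
    have := hX k le_rfl
    cases hXk : X k with
    | none => rw [hXk] at this; simp [Site.generation] at this
    | some x => simp [siteCascade]
  | succ n ih => rw [← lintegral_ascending_succ, ← ih]; congr 2; omega

/-- The probability that the walk started at the root ascends for `n` steps. -/
lemma quenchedLaw_ascending (n : ℕ) :
    quenchedLaw η (Site.vertex []) (ascending n) = cascade (weight 1 η) n [] := by
  have h := quenchedLaw_ascending_add η (Site.vertex []) n 0
  rw [zero_add] at h
  rw [h, ← lintegral_indicator (measurableSet_ascending 0)]
  have : ∀ᵐ X ∂quenchedLaw η (Site.vertex []), (ascending 0).indicator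
      (fun X => siteCascade η n (X 0)) X = cascade (weight 1 η) n [] := by
    filter_upwards [ae_quenchedLaw_zero η (Site.vertex [])] with X hX
    rw [Set.indicator_of_mem]
    · rw [hX]; rfl
    · intro k hk
      obtain rfl : k = 0 := by omega
      rw [hX]; rfl
  rw [lintegral_congr_ae this]
  simp

lemma hittingTime_of_ascending {n : ℕ} {X : ℕ → Site} (hX : X ∈ ascending n) :
    hittingTime n X = n := by
  refine le_antisymm (iInf₂_le n (hX n le_rfl)) (le_iInf₂ fun k hk => ?_)
  by_contra! h
  have hkn : k < n := by exact_mod_cast h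
  have := hX k hkn.le
  rw [hk] at this
  omega

lemma generation_hittingTime {n k : ℕ} {X : ℕ → Site} (h : hittingTime n X = k) :
    (X k).generation = n := by
  classical
  have hne : ∃ j, (X j).generation = n := by
    by_contra! hno
    have : hittingTime n X = ⊤ := by simp [hittingTime, hno]
    rw [this] at h
    exact ENat.natCast_ne_top k h.symm
  have h1 : hittingTime n X = (Nat.find hne : ℕ) := by
    refine le_antisymm (iInf₂_le (Nat.find hne) (Nat.find_spec hne)) (le_iInf₂ fun j hj => ?_)
    exact_mod_cast Nat.find_min' hne hj
  have h2 : Nat.find hne = k := by rw [h1] at h; exact_mod_cast h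
  rw [← h2]
  exact Nat.find_spec hne

/-- The walk hits generation `n` by time `n` exactly if it ascends for `n` steps. -/
lemma quenchedLaw_hittingEvent {n : ℕ} (hn : n ≠ 0) {a : ℝ} (ha : a < 1) :
    quenchedLaw η (Site.vertex []) (hittingEvent n a 1) = cascade (weight 1 η) n [] := by
  have hnpos : (0 : ℝ) < n := by exact_mod_cast Nat.pos_of_ne_zero hn
  rw [← quenchedLaw_ascending]
  refine measure_congr ?_
  filter_upwards [ae_quenchedLaw_zero η (Site.vertex []),
    ae_generation_succ_le η (Site.vertex [])] with X hX0 hX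
  refine propext ⟨?_, ?_⟩
  · rintro ⟨k, hk, -, hk1⟩
    have hkn : k ≤ n := by
      rw [div_le_one hnpos] at hk1
      exact_mod_cast hk1
    have hgen := generation_hittingTime hk
    -- From generation 0, reaching generation `n` at time `k ≤ n` forces `k = n`. Applied before and
    -- after an intermediate time `j`, the same bound pins the generation at `j` from above and from
    -- below.
    have hle : ∀ i j, (X (i + j)).generation ≤ (X i).generation + j := by
      intro i j
      induction j with
      | zero => simp
      | succ j ih =>
        have := hX (i + j)
        push_cast
        rw [← add_assoc]
        omega
    have h0 : (X 0).generation = 0 := by rw [hX0]; rfl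
    have hkn' : k = n := by
      have := hle 0 k
      rw [zero_add] at this
      omega
    subst hkn'
    intro j hj
    have h1 := hle 0 j
    rw [zero_add] at h1
    have h2 := hle j (k - j)
    rw [Nat.add_sub_cancel' hj] at h2
    omega
  · intro hX
    refine ⟨n, hittingTime_of_ascending hX, ?_, ?_⟩
    · rwa [div_self hnpos.ne']
    · rw [div_self hnpos.ne']

lemma annealedProb_hittingEvent (q : PMF ℕ) (α : Measure ℝ≥0) [IsProbabilityMeasure α] {n : ℕ}
    (hn : n ≠ 0) {a : ℝ} (ha : a < 1) :
    annealedProb q α (hittingEvent n a 1) = meanWeight q α 1 ^ n := by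
  rw [annealedProb, lintegral_congr fun η => quenchedLaw_hittingEvent η hn ha]
  exact (indepWords_bundleSigma q α).lintegral_cascade (measurable_weight 1)
    (lintegral_tsum_weight q α 1) n []

end Walk

end RWRE

/-! ### The rates at `1` and the criterion for their equality -/

theorem proposition1p3 (q : PMF ℕ) (α : Measure ℝ≥0) [IsProbabilityMeasure α]
    (hq0 : q 0 = 0)
    (hm : 1 < RWRE.meanOffspring q) (hm_fin : RWRE.meanOffspring q < ⊤)
    (hA : ∃ c C : ℝ≥0, 0 < c ∧ ∀ᵐ a ∂α, c ≤ a ∧ a ≤ C)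
    (htrans : 1 / (RWRE.meanOffspring q).toReal < sInf (RWRE.markMoment α '' Set.Icc 0 1))
    (hΛ : 1 < RWRE.bigLambda q α) :
    (∀ θ : ℝ, 0 ≤ θ → Integrable (RWRE.rootSum θ) (RWRE.envLaw q α)) ∧
    DifferentiableAt ℝ (RWRE.psi q α) 1 ∧
    BddBelow ((fun θ : ℝ => RWRE.psi q α θ / θ) '' Set.Ioc 0 1) ∧
    RWRE.IsAnnealedRateAt q α 1 (-RWRE.psi q α 1) ∧
    RWRE.IsQuenchedRateAt q α 1 (-sInf ((fun θ : ℝ => RWRE.psi q α θ / θ) '' Set.Ioc 0 1)) ∧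
    (∀ Ia1 Iq1 : ℝ, RWRE.IsAnnealedRateAt q α 1 Ia1 → RWRE.IsQuenchedRateAt q α 1 Iq1 →
      Ia1 = -RWRE.psi q α 1 ∧
      Iq1 = -sInf ((fun θ : ℝ => RWRE.psi q α θ / θ) '' Set.Ioc 0 1) ∧
      (Ia1 = Iq1 ↔ deriv (RWRE.psi q α) 1 ≤ RWRE.psi q α 1) ∧
      (¬ deriv (RWRE.psi q α) 1 ≤ RWRE.psi q α 1 → Ia1 < Iq1)) := by
  have hdiff : ∀ θ, 0 < θ → DifferentiableAt ℝ (RWRE.psi q α) θ :=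
    fun θ => RWRE.differentiableAt_psi hq0 hm_fin hA
  obtain ⟨s, hs, hmin, hleast⟩ := RWRE.exists_least_minimiser hdiff
    (RWRE.psi_zero_pos hm hm_fin) (RWRE.tendsto_psi_zero hq0 hm_fin hA)
  have hbdd : BddBelow ((fun θ : ℝ => RWRE.psi q α θ / θ) '' Set.Ioc 0 1) := by
    refine ⟨RWRE.psi q α s / s, ?_⟩
    rintro _ ⟨θ, hθ, rfl⟩
    exact hmin θ hθ
  have hann : RWRE.IsAnnealedRateAt q α 1 (-RWRE.psi q α 1) := by
    intro a ha
    rw [neg_neg]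
    refine tendsto_const_nhds.congr' ?_
    filter_upwards [eventually_ne_atTop 0] with n hn
    rw [RWRE.annealedProb_hittingEvent q α hn ha,
      RWRE.meanWeight_eq_ofReal_exp_psi hq0 hm_fin hA zero_le_one,
      ← ENNReal.ofReal_pow (Real.exp_pos _).le, ← Real.exp_nat_mul,
      RWRE.ennreal_log_ofReal_exp, RWRE.coe_natCast_mul_div n hn]
  have hque : RWRE.IsQuenchedRateAt q α 1
      (-sInf ((fun θ : ℝ => RWRE.psi q α θ / θ) '' Set.Ioc 0 1)) := by
    intro a ha
    rw [neg_neg]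
    filter_upwards [RWRE.tendsto_log_cascade_div hq0 hm hm_fin hA] with η hη
    refine hη.congr' ?_
    filter_upwards [eventually_ne_atTop 0] with n hn
    rw [RWRE.quenchedLaw_hittingEvent η hn ha]
  refine ⟨fun θ => RWRE.integrable_rootSum hm_fin, hdiff 1 one_pos, hbdd, hann, hque, ?_⟩
  intro Ia1 Iq1 ha hq
  have ea : Ia1 = -RWRE.psi q α 1 := by
    have := tendsto_nhds_unique (ha 0 one_pos) (hann 0 one_pos)
    exact neg_injective (EReal.coe_injective this)
  have eq : Iq1 = -sInf ((fun θ : ℝ => RWRE.psi q α θ / θ) '' Set.Ioc 0 1) := by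
    obtain ⟨η, h1, h2⟩ := ((hq 0 one_pos).and (hque 0 one_pos)).exists
    exact neg_injective (EReal.coe_injective (tendsto_nhds_unique h1 h2))
  have hle : sInf ((fun θ : ℝ => RWRE.psi q α θ / θ) '' Set.Ioc 0 1) ≤ RWRE.psi q α 1 :=
    csInf_le hbdd ⟨1, by simp, by simp⟩
  have hiff : Ia1 = Iq1 ↔ deriv (RWRE.psi q α) 1 ≤ RWRE.psi q α 1 := by
    rw [ea, eq, neg_inj]
    constructor
    · intro h
      -- If `1` minimises the ratio, then `ψ(θ) ≥ θ ψ(1)`, so all secant slopes from the left at `1`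
      -- are at most `ψ(1)`; the derivative is their limit.
      have hslope := (hasDerivAt_iff_tendsto_slope.1 (hdiff 1 one_pos).hasDerivAt).mono_left
        (nhdsWithin_mono 1 (fun x (hx : x < 1) => hx.ne) : 𝓝[<] (1 : ℝ) ≤ 𝓝[≠] 1)
      refine le_of_tendsto hslope ?_
      filter_upwards [Ioo_mem_nhdsLT (zero_lt_one (α := ℝ))] with θ hθ
      have h1 : RWRE.psi q α 1 ≤ RWRE.psi q α θ / θ :=
        h.le.trans (csInf_le hbdd ⟨θ, ⟨hθ.1, hθ.2.le⟩, rfl⟩)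
      rw [le_div_iff₀ hθ.1] at h1
      rw [slope_def_field, div_le_iff_of_neg (by linarith [hθ.2])]
      linarith
    · intro h
      refine le_antisymm (le_csInf ⟨_, 1, by simp, rfl⟩ ?_) hle
      rintro _ ⟨θ, hθ, rfl⟩
      rcases hθ.2.eq_or_lt with rfl | hθ1
      · simp
      -- Conversely, convexity bounds the secant slope on `[θ, 1]` by `ψ'(1) ≤ ψ(1)`, which
      -- rearranges to `ψ(θ) ≥ θ ψ(1)`.
      · have h1 := (RWRE.convexOn_psi hq0 hm_fin hA).slope_le_deriv
          (Set.mem_Ici.2 hθ.1.le) (Set.mem_Ici.2 zero_le_one) hθ1 (hdiff 1 one_pos)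
        rw [slope_def_field, div_le_iff₀ (by linarith)] at h1
        change RWRE.psi q α 1 ≤ RWRE.psi q α θ / θ
        rw [le_div_iff₀ hθ.1]
        nlinarith
  refine ⟨ea, eq, hiff, fun h => lt_of_le_of_ne ?_ fun h' => h (hiff.1 h')⟩
  rw [ea, eq]
  exact neg_le_neg hle
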